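/- Let $\omega\in\mathbb C$ be a primitive 8th root of unity, and put $$X=\begin{bmatrix}0&1\\1&0\end{bmatrix},\quad Z=\begin{bmatrix}1&0\\0&-1\end{bmatrix},\quad H=\tfrac1{\sqrt2}\begin{bmatrix}1&1\\1&-1\end{bmatrix},\quad S=\begin{bmatrix}1&0\\0&\omega^2\end{bmatrix},\quad CZ=\mathrm{diag}(1,1,1,-1).$$ For a $2\times2$ matrix $U$ and $1\le i\le n$ let $U_i=I_2^{\otimes(i-1)}\otimes U\otimes I_2^{\otimes(n-i)}$, and for $1\le i\le n-1$ let $CZ_{i\to i+1}=I_2^{\otimes(i-1)}\otimes CZ\otimes I_2^{\otimes(n-i-1)}$. Let $\mathrm{Pauli}_n=\langle X_1,\dots,X_n,Z_1,\dots,Z_n,\omega^2I\rangle\subseteq U(2^n)$, let $\mathrm{Cliff}_n$ be the normalizer of $\mathrm{Pauli}_n$ in the unitary group $U(2^n)$, and let $\mathcal C_n=\mathrm{Cliff}_n/\{cI: c\in\mathbb C,\ |c|=1\}$ be the $n$-qubit projective Clifford group. Let $h_i,s_i,\Lambda_i\in\mathcal C_n$ be the classes of $H_i$, $S_i$, $CZ_{i\to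 i+1}$. For every $n\ge1$, the centralizer of $\{s_1,\,h_1s_1h_1\}$ in $\mathcal C_n$ is $$\mathrm{Cent}_{\mathcal C_n}(\{s_1,h_1s_1h_1\})=\begin{cases}\{1\},&n=1,\\ \langle h_2,s_2\rangle,&n=2,\\ \langle h_2,\dots,h_n,\,s_2,\dots,s_n,\,\Lambda_2,\dots,\Lambda_{n-1}\rangle,&n\ge3.\end{cases}$$ Moreover, for $n\ge3$ this subgroup is a copy of $\mathcal C_{n-1}$ acting on the qubits $2,\dots,n$: the rule $[U]\mapsto[I_2\otimes U]$ for $U\in\mathrm{Cliff}_{n-1}$ is a well-defined injective group homomorphism $\mathcal C_{n-1}\to\mathcal C_n$ whose image is $\mathrm{Cent}_{\mathcal C_n}(\{s_1,h_1s_1h_1\})$. -/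

import Mathlib

open Matrix

namespace QubitClifford

noncomputable section

/-- Matrices acting on `n` qubits. The computational basis of `(ℂ²)^{⊗ n}` is indexed by the
bit strings `Fin n → Fin 2`. Qubits are numbered `0, …, n - 1`. -/
abbrev QMatrix (n : ℕ) : Type := Matrix (Fin n → Fin 2) (Fin n → Fin 2) ℂ

/-- The unitary group `U(2^n)` on `n` qubits. -/
abbrev QUnitary (n : ℕ) : Type := Matrix.unitaryGroup (Fin n → Fin 2) ℂ

/-- The tensor product `A_0 ⊗ ⋯ ⊗ A_{n-1}` of `2 × 2` matrices. -/
def tensor {n : ℕ} (A : Fin n → Matrix (Fin 2) (Fin 2) ℂ) : QMatrix n :=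
  Matrix.of fun x y => ∏ j, A j (x j) (y j)

/-- `I ⊗ ⋯ ⊗ I ⊗ U ⊗ I ⊗ ⋯ ⊗ I` with `U` at position `i`. -/
def onQubit {n : ℕ} (i : Fin n) (U : Matrix (Fin 2) (Fin 2) ℂ) : QMatrix n :=
  tensor (Function.update (fun _ => 1) i U)

/-- `I₂ ⊗ U`, the matrix `U` acting on all qubits but the first. -/
def idTensor {m : ℕ} (U : QMatrix m) : QMatrix (m + 1) :=
  Matrix.of fun x y => (1 : Matrix (Fin 2) (Fin 2) ℂ) (x 0) (y 0) * U (Fin.tail x) (Fin.tail y)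

theorem tensor_mul {n : ℕ} (A B : Fin n → Matrix (Fin 2) (Fin 2) ℂ) :
    tensor A * tensor B = tensor (fun j => A j * B j) := by
  ext x y
  simp only [tensor, Matrix.mul_apply, Matrix.of_apply, ← Finset.prod_mul_distrib]
  rw [Finset.prod_univ_sum, Fintype.piFinset_univ]

theorem tensor_one {n : ℕ} :
    tensor (fun _ : Fin n => (1 : Matrix (Fin 2) (Fin 2) ℂ)) = 1 := by
  ext x y
  simp only [tensor, Matrix.of_apply, Matrix.one_apply]
  by_cases h : x = y
  · simp [h]
  · obtain ⟨j, hj⟩ := Function.ne_iff.mp h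
    rw [if_neg h]
    exact Finset.prod_eq_zero (Finset.mem_univ j) (by simp [hj])

theorem tensor_star {n : ℕ} (A : Fin n → Matrix (Fin 2) (Fin 2) ℂ) :
    star (tensor A) = tensor (fun j => star (A j)) := by
  ext x y
  simp [tensor, Matrix.star_apply]

theorem onQubit_mul {n : ℕ} (i : Fin n) (U V : Matrix (Fin 2) (Fin 2) ℂ) :
    onQubit i U * onQubit i V = onQubit i (U * V) := by
  rw [onQubit, onQubit, tensor_mul, onQubit]
  congr 1
  funext j
  by_cases h : j = i
  · subst h; simp
  · simp [h]

theorem onQubit_one {n : ℕ} (i : Fin n) : onQubit i 1 = 1 := by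
  rw [onQubit, ← tensor_one]
  congr 1
  funext j
  by_cases h : j = i
  · subst h; simp
  · simp [h]

theorem onQubit_star {n : ℕ} (i : Fin n) (U : Matrix (Fin 2) (Fin 2) ℂ) :
    star (onQubit i U) = onQubit i (star U) := by
  rw [onQubit, tensor_star, onQubit]
  congr 1
  funext j
  by_cases h : j = i
  · subst h; simp
  · simp [h]

theorem onQubit_comm {n : ℕ} {i j : Fin n} (hij : i ≠ j) (U V : Matrix (Fin 2) (Fin 2) ℂ) :
    onQubit i U * onQubit j V = onQubit j V * onQubit i U := by
  rw [onQubit, onQubit, tensor_mul, tensor_mul]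
  congr 1
  funext k
  by_cases h : k = i
  · subst h; simp [hij]
  · simp [h]

theorem onQubit_apply {n : ℕ} (i : Fin n) (U : Matrix (Fin 2) (Fin 2) ℂ) (x y : Fin n → Fin 2) :
    onQubit i U x y = if ∀ k, k ≠ i → x k = y k then U (x i) (y i) else 0 := by
  simp only [onQubit, tensor, Matrix.of_apply]
  split_ifs with h
  · rw [Finset.prod_eq_single i]
    · simp
    · intro k _ hk
      simp [hk, h k hk]
    · simp
  · push Not at h
    obtain ⟨k, hk, hne⟩ := h
    exact Finset.prod_eq_zero (Finset.mem_univ k) (by simp [hk, hne])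

/-- A one-qubit gate `U` placed on qubit `i`. -/
def gateOn {n : ℕ} (i : Fin n) (U : Matrix.unitaryGroup (Fin 2) ℂ) : QUnitary n :=
  ⟨onQubit i U, by
    rw [Matrix.mem_unitaryGroup_iff, onQubit_star, onQubit_mul,
      Matrix.mem_unitaryGroup_iff.mp U.2, onQubit_one]⟩

/-- The Pauli matrix `X`. -/
def matX : Matrix.unitaryGroup (Fin 2) ℂ :=
  ⟨!![0, 1; 1, 0], by
    rw [Matrix.mem_unitaryGroup_iff]
    ext i j; fin_cases i <;> fin_cases j <;> simp [Matrix.mul_apply, Matrix.star_apply]⟩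

/-- The Pauli matrix `Z`. -/
def matZ : Matrix.unitaryGroup (Fin 2) ℂ :=
  ⟨!![1, 0; 0, -1], by
    rw [Matrix.mem_unitaryGroup_iff]
    ext i j; fin_cases i <;> fin_cases j <;> simp [Matrix.mul_apply, Matrix.star_apply]⟩

theorem inv_sqrt_two_mul_self : ((Real.sqrt 2 : ℂ))⁻¹ * ((Real.sqrt 2 : ℂ))⁻¹ = 1 / 2 := by
  rw [← mul_inv, ← Complex.ofReal_mul, Real.mul_self_sqrt (by norm_num)]
  norm_num

/-- The Hadamard matrix `H`. -/
def matH : Matrix.unitaryGroup (Fin 2) ℂ :=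
  ⟨((Real.sqrt 2 : ℂ))⁻¹ • !![1, 1; 1, -1], by
    rw [Matrix.mem_unitaryGroup_iff]
    ext i j
    fin_cases i <;> fin_cases j <;>
      simp [Matrix.mul_apply, Matrix.star_apply, inv_sqrt_two_mul_self] <;> norm_num⟩

theorem mul_conj_root {ω : ℂ} (hω : IsPrimitiveRoot ω 8) : ω * star ω = 1 := by
  have h : ‖ω‖ = 1 := hω.norm'_eq_one (by norm_num)
  have h2 := Complex.mul_conj ω
  rw [Complex.normSq_eq_norm_sq, h] at h2
  simpa using h2

theorem root_pow_four {ω : ℂ} (hω : IsPrimitiveRoot ω 8) : ω ^ 4 = -1 := by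
  have h : (ω ^ 4 - 1) * (ω ^ 4 + 1) = 0 := by
    have := hω.pow_eq_one
    linear_combination this
  rcases mul_eq_zero.mp h with h | h
  · exact absurd (sub_eq_zero.mp h) (hω.pow_ne_one_of_pos_of_lt (by norm_num) (by norm_num))
  · linear_combination h

/-- The phase matrix `S = diag(1, ω²)`, where `ω` is a primitive eighth root of unity. -/
def matS {ω : ℂ} (hω : IsPrimitiveRoot ω 8) : Matrix.unitaryGroup (Fin 2) ℂ :=
  ⟨!![1, 0; 0, ω ^ 2], by
    have h := mul_conj_root hω
    have h2 : ω ^ 2 * (star ω) ^ 2 = 1 := by rw [← mul_pow, h, one_pow]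
    rw [Matrix.mem_unitaryGroup_iff]
    ext i j; fin_cases i <;> fin_cases j <;>
      simp [Matrix.mul_apply, Matrix.star_apply]
    simpa using h2⟩

/-- The scalar matrix `ω² I`. -/
def scalarI {ω : ℂ} (hω : IsPrimitiveRoot ω 8) (n : ℕ) : QUnitary n :=
  ⟨(ω ^ 2) • (1 : QMatrix n), by
    have h2 : ω ^ 2 * (star ω) ^ 2 = 1 := by rw [← mul_pow, mul_conj_root hω, one_pow]
    rw [Matrix.mem_unitaryGroup_iff, star_smul, star_one, smul_mul_smul_comm, star_pow, h2]
    simp⟩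

/-- The controlled `Z` gate on qubits `i` and `i + 1` of `m + 1` qubits: the diagonal matrix whose
sign is `-1` exactly on the basis states where both qubits are `1`. -/
def gateCZ {m : ℕ} (i : Fin m) : QUnitary (m + 1) :=
  ⟨Matrix.diagonal fun x => if x i.castSucc = 1 ∧ x i.succ = 1 then -1 else 1, by
    rw [Matrix.mem_unitaryGroup_iff, Matrix.star_eq_conjTranspose,
      Matrix.diagonal_conjTranspose, Matrix.diagonal_mul_diagonal, ← Matrix.diagonal_one]
    congr 1
    funext x
    simp only [Pi.star_apply]
    split_ifs <;> simp⟩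

/-- The `n`-qubit Pauli group, generated by the `X_i`, the `Z_i` and `ω² I`. -/
def pauliGroup {ω : ℂ} (hω : IsPrimitiveRoot ω 8) (n : ℕ) : Subgroup (QUnitary n) :=
  Subgroup.closure
    (Set.range (fun i => gateOn i matX) ∪ Set.range (fun i => gateOn i matZ) ∪ {scalarI hω n})

/-- The `n`-qubit Clifford group: the normalizer of the Pauli group in `U(2^n)`. -/
def cliffordGroup {ω : ℂ} (hω : IsPrimitiveRoot ω 8) (n : ℕ) : Subgroup (QUnitary n) :=
  Subgroup.normalizer (pauliGroup hω n : Set (QUnitary n))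

/-- The global phases: the scalar matrices in the Clifford group. -/
def globalPhases {ω : ℂ} (hω : IsPrimitiveRoot ω 8) (n : ℕ) : Subgroup (cliffordGroup hω n) where
  carrier := {U | ∃ c : ℂ, ((U : QUnitary n) : QMatrix n) = c • (1 : QMatrix n)}
  one_mem' := ⟨1, by simp⟩
  mul_mem' := by
    rintro U V ⟨c, hc⟩ ⟨d, hd⟩
    exact ⟨c * d, by simp [hc, hd, smul_smul, mul_comm]⟩
  inv_mem' := by
    rintro U ⟨c, hc⟩
    exact ⟨star c, by simp [hc, Matrix.UnitaryGroup.inv_val]⟩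

instance globalPhases_normal {ω : ℂ} (hω : IsPrimitiveRoot ω 8) (n : ℕ) :
    (globalPhases hω n).Normal where
  conj_mem := by
    rintro U ⟨c, hc⟩ V
    refine ⟨c, ?_⟩
    have h : ((V : QUnitary n) : QMatrix n) * star ((V : QUnitary n) : QMatrix n) = 1 :=
      Matrix.mem_unitaryGroup_iff.mp (V : QUnitary n).2
    simp [hc, Matrix.UnitaryGroup.inv_val, h]

/-- The projective Clifford group `𝒞_n`: Clifford operators up to a global phase. -/
abbrev ProjClifford {ω : ℂ} (hω : IsPrimitiveRoot ω 8) (n : ℕ) : Type :=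
  cliffordGroup hω n ⧸ globalPhases hω n

theorem gateOn_mul {n : ℕ} (i : Fin n) (U V : Matrix.unitaryGroup (Fin 2) ℂ) :
    gateOn i U * gateOn i V = gateOn i (U * V) :=
  Subtype.ext (onQubit_mul i _ _)

theorem gateOn_comm {n : ℕ} {i j : Fin n} (hij : i ≠ j) (U V : Matrix.unitaryGroup (Fin 2) ℂ) :
    gateOn i U * gateOn j V = gateOn j V * gateOn i U :=
  Subtype.ext (onQubit_comm hij _ _)

theorem gateOn_one {n : ℕ} (i : Fin n) : gateOn i 1 = 1 :=
  Subtype.ext (onQubit_one i)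

theorem X_mem {ω : ℂ} (hω : IsPrimitiveRoot ω 8) {n : ℕ} (i : Fin n) :
    gateOn i matX ∈ pauliGroup hω n :=
  Subgroup.subset_closure (Or.inl (Or.inl ⟨i, rfl⟩))

theorem Z_mem {ω : ℂ} (hω : IsPrimitiveRoot ω 8) {n : ℕ} (i : Fin n) :
    gateOn i matZ ∈ pauliGroup hω n :=
  Subgroup.subset_closure (Or.inl (Or.inr ⟨i, rfl⟩))

theorem scalarI_mem {ω : ℂ} (hω : IsPrimitiveRoot ω 8) (n : ℕ) :
    scalarI hω n ∈ pauliGroup hω n :=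
  Subgroup.subset_closure (Or.inr rfl)

/-- A unitary of finite order that conjugates each `X_i` and `Z_i` into the Pauli group is
Clifford. -/
theorem mem_clifford {ω : ℂ} (hω : IsPrimitiveRoot ω 8) {n : ℕ} (U : QUnitary n) (k : ℕ)
    (hk : U ^ (k + 1) = 1)
    (hX : ∀ j, ∃ P ∈ pauliGroup hω n, U * gateOn j matX = P * U)
    (hZ : ∀ j, ∃ P ∈ pauliGroup hω n, U * gateOn j matZ = P * U) :
    U ∈ cliffordGroup hω n := by
  have h1 : ∀ P ∈ pauliGroup hω n, U * P * U⁻¹ ∈ pauliGroup hω n := by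
    have h : pauliGroup hω n ≤ (pauliGroup hω n).comap (MulAut.conj U).toMonoidHom := by
      conv_lhs => rw [pauliGroup]
      rw [Subgroup.closure_le]
      rintro _ ((⟨j, rfl⟩ | ⟨j, rfl⟩) | rfl)
      · obtain ⟨P, hP, e⟩ := hX j
        simpa [e] using hP
      · obtain ⟨P, hP, e⟩ := hZ j
        simpa [e] using hP
      · have e : U * scalarI hω n = scalarI hω n * U := by
          apply Subtype.ext
          simp [scalarI]
        simpa [e] using scalarI_mem hω n
    intro P hP
    simpa using h hP
  have h2 : ∀ r : ℕ, ∀ P ∈ pauliGroup hω n, U ^ r * P * (U ^ r)⁻¹ ∈ pauliGroup hω n := by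
    intro r
    induction r with
    | zero => simp
    | succ r ih =>
      intro P hP
      have := h1 _ (ih P hP)
      simpa [pow_succ', mul_assoc] using this
  have h3 : U ^ k = U⁻¹ := by
    rw [eq_inv_iff_mul_eq_one, ← pow_succ, hk]
  rw [cliffordGroup, Subgroup.mem_normalizer_iff]
  refine fun P => ⟨h1 P, fun hP => ?_⟩
  have := h2 k _ hP
  rw [h3] at this
  simpa [mul_assoc] using this

theorem matH_sq : matH * matH = 1 := by
  apply Subtype.ext
  ext i j
  fin_cases i <;> fin_cases j <;>
    simp [matH, inv_sqrt_two_mul_self] <;> norm_num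

theorem matH_X : matH * matX = matZ * matH := by
  apply Subtype.ext
  ext i j
  fin_cases i <;> fin_cases j <;> simp [matH, matX, matZ]

theorem matH_Z : matH * matZ = matX * matH := by
  apply Subtype.ext
  ext i j
  fin_cases i <;> fin_cases j <;> simp [matH, matX, matZ]

theorem gateH_mem {ω : ℂ} (hω : IsPrimitiveRoot ω 8) {n : ℕ} (i : Fin n) :
    gateOn i matH ∈ cliffordGroup hω n := by
  refine mem_clifford hω _ 1 ?_ (fun j => ?_) (fun j => ?_)
  · rw [pow_succ, pow_one, gateOn_mul, matH_sq, gateOn_one]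
  · by_cases h : i = j
    · subst h
      exact ⟨_, Z_mem hω i, by rw [gateOn_mul, gateOn_mul, matH_X]⟩
    · exact ⟨_, X_mem hω j, gateOn_comm h _ _⟩
  · by_cases h : i = j
    · subst h
      exact ⟨_, X_mem hω i, by rw [gateOn_mul, gateOn_mul, matH_Z]⟩
    · exact ⟨_, Z_mem hω j, gateOn_comm h _ _⟩

theorem matS_pow {ω : ℂ} (hω : IsPrimitiveRoot ω 8) :
    matS hω * matS hω * (matS hω * matS hω) = 1 := by
  have h := hω.pow_eq_one
  apply Subtype.ext
  ext i j
  fin_cases i <;> fin_cases j <;> simp [matS]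
  linear_combination h

theorem matS_Z {ω : ℂ} (hω : IsPrimitiveRoot ω 8) : matS hω * matZ = matZ * matS hω := by
  apply Subtype.ext
  ext i j
  fin_cases i <;> fin_cases j <;> simp [matS, matZ]

theorem matS_X {ω : ℂ} (hω : IsPrimitiveRoot ω 8) :
    ((matS hω * matX : Matrix.unitaryGroup (Fin 2) ℂ) : Matrix (Fin 2) (Fin 2) ℂ) =
      ω ^ 2 • ((matX * matZ * matS hω : Matrix.unitaryGroup (Fin 2) ℂ) :
        Matrix (Fin 2) (Fin 2) ℂ) := by
  have h := root_pow_four hω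
  ext i j
  fin_cases i <;> fin_cases j <;> simp [matS, matX, matZ]
  linear_combination h

theorem onQubit_smul {n : ℕ} (i : Fin n) (c : ℂ) (U : Matrix (Fin 2) (Fin 2) ℂ) :
    onQubit i (c • U) = c • onQubit i U := by
  ext x y
  simp [onQubit_apply]

theorem gateS_mem {ω : ℂ} (hω : IsPrimitiveRoot ω 8) {n : ℕ} (i : Fin n) :
    gateOn i (matS hω) ∈ cliffordGroup hω n := by
  refine mem_clifford hω _ 3 ?_ (fun j => ?_) (fun j => ?_)
  · have : gateOn i (matS hω) ^ (3 + 1) =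
        gateOn i (matS hω) * gateOn i (matS hω) * (gateOn i (matS hω) * gateOn i (matS hω)) := by
      simp only [pow_succ, pow_zero, one_mul, mul_assoc]
    rw [this, gateOn_mul, gateOn_mul, matS_pow, gateOn_one]
  · by_cases h : i = j
    · subst h
      refine ⟨scalarI hω n * (gateOn i matX * gateOn i matZ),
        mul_mem (scalarI_mem hω n) (mul_mem (X_mem hω i) (Z_mem hω i)), ?_⟩
      rw [mul_assoc, gateOn_mul, gateOn_mul, gateOn_mul]
      apply Subtype.ext
      change onQubit i _ = (ω ^ 2 • (1 : QMatrix n)) * onQubit i _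
      rw [smul_mul_assoc, one_mul, ← onQubit_smul, matS_X]
    · exact ⟨_, X_mem hω j, gateOn_comm h _ _⟩
  · by_cases h : i = j
    · subst h
      exact ⟨_, Z_mem hω i, by rw [gateOn_mul, gateOn_mul, matS_Z]⟩
    · exact ⟨_, Z_mem hω j, gateOn_comm h _ _⟩

theorem onQubit_Z {n : ℕ} (i : Fin n) :
    onQubit i (matZ : Matrix (Fin 2) (Fin 2) ℂ) =
      Matrix.diagonal fun x => if x i = 1 then -1 else 1 := by
  ext x y
  rw [onQubit_apply, Matrix.diagonal_apply]
  by_cases h : x = y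
  · subst h
    rcases Fin.exists_fin_two.mp ⟨x i, rfl⟩ with h | h <;> simp [matZ, h]
  · rw [if_neg h]
    split_ifs with hk
    · have hi : x i ≠ y i := by
        intro hi
        apply h
        funext k
        by_cases hki : k = i
        · rw [hki, hi]
        · exact hk k hki
      generalize x i = a at hi
      generalize y i = b at hi
      fin_cases a <;> fin_cases b <;> simp_all [matZ]
    · rfl

theorem gateCZ_sq {m : ℕ} (i : Fin m) : gateCZ i * gateCZ i = 1 := by
  apply Subtype.ext
  change Matrix.diagonal _ * Matrix.diagonal _ = (1 : QMatrix (m + 1))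
  rw [Matrix.diagonal_mul_diagonal, ← Matrix.diagonal_one]
  congr 1
  funext x
  split_ifs <;> simp

theorem gateCZ_Z {m : ℕ} (i : Fin m) (j : Fin (m + 1)) :
    gateCZ i * gateOn j matZ = gateOn j matZ * gateCZ i := by
  apply Subtype.ext
  change Matrix.diagonal _ * onQubit j _ = onQubit j _ * Matrix.diagonal _
  rw [onQubit_Z, Matrix.diagonal_mul_diagonal, Matrix.diagonal_mul_diagonal]
  congr 1
  funext x
  exact mul_comm _ _

theorem gateCZ_X_other {m : ℕ} (i : Fin m) (j : Fin (m + 1)) (h1 : j ≠ i.castSucc)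
    (h2 : j ≠ i.succ) : gateCZ i * gateOn j matX = gateOn j matX * gateCZ i := by
  apply Subtype.ext
  change Matrix.diagonal _ * onQubit j _ = onQubit j _ * Matrix.diagonal _
  ext x y
  rw [Matrix.diagonal_mul, Matrix.mul_diagonal, onQubit_apply]
  by_cases h : ∀ k, k ≠ j → x k = y k
  · rw [h _ h1.symm, h _ h2.symm, mul_comm]
  · simp [h]

theorem gateCZ_X_left {m : ℕ} (i : Fin m) :
    gateCZ i * gateOn i.castSucc matX =
      gateOn i.castSucc matX * gateOn i.succ matZ * gateCZ i := by
  have hne : i.succ ≠ i.castSucc := i.castSucc_lt_succ.ne'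
  apply Subtype.ext
  change Matrix.diagonal _ * onQubit _ _ = onQubit _ _ * onQubit _ _ * Matrix.diagonal _
  rw [onQubit_Z]
  ext x y
  rw [Matrix.diagonal_mul, Matrix.mul_diagonal, Matrix.mul_diagonal, onQubit_apply]
  by_cases h : ∀ k, k ≠ i.castSucc → x k = y k
  · rw [h _ hne, if_pos h]
    generalize x i.castSucc = a
    generalize y i.castSucc = b
    generalize y i.succ = c
    fin_cases a <;> fin_cases b <;> fin_cases c <;> simp [matX]
  · simp [h]

theorem gateCZ_X_right {m : ℕ} (i : Fin m) :
    gateCZ i * gateOn i.succ matX =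
      gateOn i.succ matX * gateOn i.castSucc matZ * gateCZ i := by
  have hne : i.castSucc ≠ i.succ := i.castSucc_lt_succ.ne
  apply Subtype.ext
  change Matrix.diagonal _ * onQubit _ _ = onQubit _ _ * onQubit _ _ * Matrix.diagonal _
  rw [onQubit_Z]
  ext x y
  rw [Matrix.diagonal_mul, Matrix.mul_diagonal, Matrix.mul_diagonal, onQubit_apply]
  by_cases h : ∀ k, k ≠ i.succ → x k = y k
  · rw [h _ hne, if_pos h]
    generalize x i.succ = a
    generalize y i.succ = b
    generalize y i.castSucc = c
    fin_cases a <;> fin_cases b <;> fin_cases c <;> simp [matX]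
  · simp [h]

theorem gateCZ_mem {ω : ℂ} (hω : IsPrimitiveRoot ω 8) {m : ℕ} (i : Fin m) :
    gateCZ i ∈ cliffordGroup hω (m + 1) := by
  refine mem_clifford hω _ 1 ?_ (fun j => ?_) (fun j => ?_)
  · rw [pow_succ, pow_one, gateCZ_sq]
  · by_cases h1 : j = i.castSucc
    · subst h1
      exact ⟨_, mul_mem (X_mem hω _) (Z_mem hω _), gateCZ_X_left i⟩
    · by_cases h2 : j = i.succ
      · subst h2
        exact ⟨_, mul_mem (X_mem hω _) (Z_mem hω _), gateCZ_X_right i⟩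
      · exact ⟨_, X_mem hω j, gateCZ_X_other i j h1 h2⟩
  · exact ⟨_, Z_mem hω j, gateCZ_Z i j⟩

/-- The quotient map from the Clifford group to the projective Clifford group. -/
def proj {ω : ℂ} (hω : IsPrimitiveRoot ω 8) (n : ℕ) : cliffordGroup hω n →* ProjClifford hω n :=
  QuotientGroup.mk' (globalPhases hω n)

/-- The class of the Hadamard gate on qubit `i`. -/
def hGate {ω : ℂ} (hω : IsPrimitiveRoot ω 8) {n : ℕ} (i : Fin n) : ProjClifford hω n :=
  proj hω n ⟨gateOn i matH, gateH_mem hω i⟩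

/-- The class of the phase gate on qubit `i`. -/
def sGate {ω : ℂ} (hω : IsPrimitiveRoot ω 8) {n : ℕ} (i : Fin n) : ProjClifford hω n :=
  proj hω n ⟨gateOn i (matS hω), gateS_mem hω i⟩

/-- The class of the controlled `Z` gate on qubits `i` and `i + 1`. -/
def lamGate {ω : ℂ} (hω : IsPrimitiveRoot ω 8) {m : ℕ} (i : Fin m) : ProjClifford hω (m + 1) :=
  proj hω (m + 1) ⟨gateCZ i, gateCZ_mem hω i⟩

/-- The common centralizer of `s` and `h s h` on the first qubit. -/
def commonCentralizer {ω : ℂ} (hω : IsPrimitiveRoot ω 8) (m : ℕ) :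
    Subgroup (ProjClifford hω (m + 1)) :=
  Subgroup.centralizer {sGate hω 0, hGate hω 0 * sGate hω 0 * hGate hω 0}

end

end QubitClifford

/-!
Modulo scalars `S² = Z` and `(HSH)² = X`. A Clifford unitary commuting with `S_0` up to a phase
commutes with it exactly, because `S_0` has nonzero trace, and the same holds for `(HSH)_0`. Hence a
representative of an element of the centralizer commutes with `X_0` and `Z_0`, so it has the form
`I ⊗ V`; and `V` is Clifford because a Pauli operator `I ⊗ P` forces `P` to be Pauli. Thus the
centralizer is the image of the projective Clifford group of the remaining qubits.

The gates `h_i`, `s_i`, `Λ_i` generate the whole projective Clifford group: by induction on the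
number of qubits they conjugate every nontrivial Pauli class to that of `X_0`, and those of them
fixing `X_0` conjugate every Pauli anticommuting with `X_0` to `Z_0`. Up to a product of gates, a
Clifford class therefore fixes both `X_0` and `Z_0`; after a further Pauli correction it commutes
with them exactly and comes from one qubit fewer.
-/

open scoped Kronecker

namespace QubitClifford

noncomputable section

theorem exists_eq_smul_one_of_kronecker_eq {K m n p : Type*} [Field K] [DecidableEq m]
    {A : Matrix m m K} {B C : Matrix n p K} (hB : B ≠ 0) (h : A ⊗ₖ B = 1 ⊗ₖ C) :
    ∃ c : K, A = c • (1 : Matrix m m K) := by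
  obtain ⟨x, y, hxy⟩ : ∃ x y, B x y ≠ 0 := by
    by_contra! h0
    exact hB (Matrix.ext h0)
  refine ⟨C x y / B x y, ?_⟩
  ext a b
  have := congr_fun₂ h (a, x) (b, y)
  rw [kronecker_apply, kronecker_apply] at this
  rw [Matrix.smul_apply, smul_eq_mul, div_mul_eq_mul_div, eq_div_iff hxy, this, mul_comm]

theorem sum_fin_cons {m : ℕ} {α M : Type*} [Fintype α] [AddCommMonoid M]
    (f : (Fin (m + 1) → α) → M) : ∑ x, f x = ∑ a, ∑ x, f (Fin.cons a x) := by
  rw [← (Fin.consEquiv fun _ => α).sum_comp, Fintype.sum_prod_type]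
  rfl

theorem commute_of_mul_eq_smul_mul {ι R : Type*} [Fintype ι] [DecidableEq ι] [CommRing R]
    [IsDomain R] {U A : Matrix ι ι R} {c : R} (hU : IsUnit U) (h : U * A = c • (A * U))
    (hA : A.trace ≠ 0) : Commute U A := by
  obtain ⟨U, rfl⟩ := hU
  have hconj : U.val * A * U⁻¹.val = c • A := by rw [h, smul_mul_assoc, Units.mul_inv_cancel_right]
  have htrace : A.trace = c * A.trace := by
    rw [← smul_eq_mul, ← trace_smul, ← hconj, trace_units_conj]
  have hc : c = 1 := mul_right_cancel₀ hA (htrace.symm.trans (one_mul _).symm)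
  rw [Commute, SemiconjBy, h, hc, one_smul]

theorem mul_eq_mul_or_eq_neg_of_eq_smul {K A : Type*} [Field K] [Ring A] [Algebra K A]
    {u a : A} {c : K} (ha : a * a = 1) (h : u * a = c • (a * u)) :
    u * a = a * u ∨ u * a = -(a * u) := by
  have hcc : (c * c) • u = u := calc
    (c * c) • u = c • (a * (c • (a * u))) := by
      rw [mul_smul_comm, ← mul_assoc, ha, one_mul, smul_smul]
    _ = u := by rw [← h, ← mul_assoc, ← smul_mul_assoc, ← h, mul_assoc, ha, mul_one]
  have h0 : (c * c - 1) • u = 0 := by rw [sub_smul, hcc, one_smul, sub_self]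
  obtain hc | rfl := smul_eq_zero.mp h0
  · obtain rfl | rfl := mul_self_eq_one_iff.mp (sub_eq_zero.mp hc)
    · exact Or.inl (by rw [h, one_smul])
    · exact Or.inr (by rw [h, neg_one_smul])
  · simp

/-- Every representative of `a` commutes with every representative of `b`. This is finer than
`Commute a b`: modulo scalars, anticommuting matrices commute as well. -/
def LiftsCommute {G : Type*} [Group G] {N : Subgroup G} (a b : G ⧸ N) : Prop :=
  ∀ A B : G, (A : G ⧸ N) = a → (B : G ⧸ N) = b → Commute A B

namespace LiftsCommute

variable {G : Type*} [Group G] {N : Subgroup G}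

theorem symm {a b : G ⧸ N} (h : LiftsCommute a b) : LiftsCommute b a :=
  fun B A hB hA => (h A B hA hB).symm

theorem of_commute (hN : N ≤ Subgroup.center G) {A B : G} (h : Commute A B) :
    LiftsCommute (A : G ⧸ N) (B : G ⧸ N) := by
  intro A' B' hA hB
  have central {C C' : G} (hC : (C' : G ⧸ N) = C) (D : G) : Commute (C⁻¹ * C') D :=
    (Subgroup.mem_center_iff.mp (hN (QuotientGroup.eq.mp hC.symm)) D).symm
  rw [← mul_inv_cancel_left A A', ← mul_inv_cancel_left B B']
  exact (h.mul_right (central hB A).symm).mul_left (central hA _)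

variable [N.Normal]

theorem mul_right {a b c : G ⧸ N} (hb : LiftsCommute a b) (hc : LiftsCommute a c) :
    LiftsCommute a (b * c) := by
  intro A D hA hD
  obtain ⟨B, rfl⟩ := QuotientGroup.mk_surjective b
  have hBD : ((B⁻¹ * D : G) : G ⧸ N) = c := by
    rw [QuotientGroup.mk_mul, hD, QuotientGroup.mk_inv, inv_mul_cancel_left]
  simpa using (hb A B hA rfl).mul_right (hc A _ hA hBD)

theorem mul_left {a b c : G ⧸ N} (ha : LiftsCommute a c) (hb : LiftsCommute b c) :
    LiftsCommute (a * b) c :=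
  (ha.symm.mul_right hb.symm).symm

theorem of_semiconjBy {g a a' b b' : G ⧸ N} (h : LiftsCommute a b) (ha : SemiconjBy g a a')
    (hb : SemiconjBy g b b') : LiftsCommute a' b' := by
  intro A B hA hB
  obtain ⟨U, rfl⟩ := QuotientGroup.mk_surjective g
  have lift {c c' : G ⧸ N} {C : G} (hc : SemiconjBy (U : G ⧸ N) c c') (hC : (C : G ⧸ N) = c') :
      ((U⁻¹ * C * U⁻¹⁻¹ : G) : G ⧸ N) = c := by
    rw [inv_inv, QuotientGroup.mk_mul, QuotientGroup.mk_mul, hC, QuotientGroup.mk_inv, mul_assoc,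
      ← hc.eq, inv_mul_cancel_left]
  exact (Commute.conj_iff U⁻¹).mp (h _ _ (lift ha hA) (lift hb hB))

end LiftsCommute

/-- Conjugacy of `a` and `b` by an element of the subgroup `K`. -/
def IsConjIn {G : Type*} [Group G] (K : Subgroup G) (a b : G) : Prop :=
  ∃ g ∈ K, SemiconjBy g a b

namespace IsConjIn

variable {G : Type*} [Group G] {K L : Subgroup G} {a b c : G}

theorem refl (K : Subgroup G) (a : G) : IsConjIn K a a :=
  ⟨1, K.one_mem, .one_left a⟩

theorem symm (h : IsConjIn K a b) : IsConjIn K b a := by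
  obtain ⟨g, hg, hab⟩ := h
  exact ⟨g⁻¹, K.inv_mem hg, hab.inv_symm_left⟩

theorem trans (hab : IsConjIn K a b) (hbc : IsConjIn K b c) : IsConjIn K a c := by
  obtain ⟨g, hg, hab⟩ := hab
  obtain ⟨g', hg', hbc⟩ := hbc
  exact ⟨g' * g, K.mul_mem hg' hg, hbc.mul_left hab⟩

theorem mono (hKL : K ≤ L) (h : IsConjIn K a b) : IsConjIn L a b :=
  h.imp fun _ hg => hg.imp_left (hKL ·)

end IsConjIn

variable {ω : ℂ} {hω : IsPrimitiveRoot ω 8} {n m : ℕ}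

/-! ### Tensoring on the first qubit -/

/-- The homomorphism `(u, Q) ↦ u ⊗ Q`, placing `u` on the first qubit and `Q` on the others. -/
def consTensor (m : ℕ) : Matrix.unitaryGroup (Fin 2) ℂ × QUnitary m →* QUnitary (m + 1) where
  toFun p := ⟨((p.1 : Matrix (Fin 2) (Fin 2) ℂ) ⊗ₖ (p.2 : QMatrix m)).submatrix
      (Fin.consEquiv fun _ => Fin 2).symm (Fin.consEquiv fun _ => Fin 2).symm, by
    rw [mem_unitaryGroup_iff, star_eq_conjTranspose, conjTranspose_submatrix,
      submatrix_mul_equiv, ← star_eq_conjTranspose,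
      mem_unitaryGroup_iff.mp (kronecker_mem_unitary p.1.2 p.2.2), submatrix_one_equiv]⟩
  map_one' := Subtype.ext <| by simp
  map_mul' p q := Subtype.ext <| by simp [mul_kronecker_mul]

/-- The homomorphism `Q ↦ I₂ ⊗ Q` of unitary groups. -/
def idTensorHom (m : ℕ) : QUnitary m →* QUnitary (m + 1) :=
  (consTensor m).comp (MonoidHom.inr _ _)

theorem coe_consTensor_apply (u : Matrix.unitaryGroup (Fin 2) ℂ) (Q : QUnitary m)
    (x y : Fin (m + 1) → Fin 2) :
    (consTensor m (u, Q) : QMatrix (m + 1)) x y =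
      (u : Matrix (Fin 2) (Fin 2) ℂ) (x 0) (y 0) * (Q : QMatrix m) (Fin.tail x) (Fin.tail y) :=
  rfl

theorem coe_idTensorHom (Q : QUnitary m) :
    (idTensorHom m Q : QMatrix (m + 1)) = idTensor (Q : QMatrix m) :=
  rfl

theorem consTensor_one_right (u : Matrix.unitaryGroup (Fin 2) ℂ) :
    consTensor m (u, 1) = gateOn 0 u := by
  ext x y
  have hone : (1 : QMatrix m) (Fin.tail x) (Fin.tail y) =
      ∏ i : Fin m, (1 : Matrix (Fin 2) (Fin 2) ℂ) (x i.succ) (y i.succ) := by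
    rw [← tensor_one]
    rfl
  rw [coe_consTensor_apply, UnitaryGroup.one_val, hone]
  simp [gateOn, onQubit, tensor, Fin.prod_univ_succ]

theorem idTensorHom_gateOn (i : Fin m) (u : Matrix.unitaryGroup (Fin 2) ℂ) :
    idTensorHom m (gateOn i u) = gateOn i.succ u := by
  ext x y
  rw [coe_idTensorHom]
  simp [idTensor, gateOn, onQubit, tensor, Fin.prod_univ_succ, Fin.tail, Function.update_apply,
    (Fin.succ_ne_zero i).symm]

theorem idTensor_eq_submatrix (U : QMatrix m) :
    idTensor U = ((1 : Matrix (Fin 2) (Fin 2) ℂ) ⊗ₖ U).submatrix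
      (Fin.consEquiv fun _ => Fin 2).symm (Fin.consEquiv fun _ => Fin 2).symm :=
  rfl

theorem idTensor_cons (U : QMatrix m) (a b : Fin 2) (x y : Fin m → Fin 2) :
    idTensor U (Fin.cons a x) (Fin.cons b y) = (1 : Matrix (Fin 2) (Fin 2) ℂ) a b * U x y :=
  rfl

theorem idTensor_diagonal (d : (Fin m → Fin 2) → ℂ) :
    idTensor (diagonal d) = diagonal (d ∘ Fin.tail) := by
  simp only [idTensor_eq_submatrix, ← diagonal_one (n := Fin 2), diagonal_kronecker_diagonal,
    submatrix_diagonal_equiv, one_mul]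
  rfl

theorem idTensorHom_gateCZ (i : Fin m) :
    idTensorHom (m + 1) (gateCZ i) = gateCZ i.succ :=
  Subtype.ext (idTensor_diagonal _)

theorem idTensor_smul (c : ℂ) (U : QMatrix m) : idTensor (c • U) = c • idTensor U := by
  simp only [idTensor_eq_submatrix, kronecker_smul]
  rfl

theorem idTensor_one : idTensor (1 : QMatrix m) = 1 := by
  simp [idTensor_eq_submatrix]

theorem idTensor_mul (U V : QMatrix m) : idTensor (U * V) = idTensor U * idTensor V := by
  simp [idTensor_eq_submatrix, ← mul_kronecker_mul]

theorem star_idTensor (U : QMatrix m) : star (idTensor U) = idTensor (star U) := by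
  simp [idTensor_eq_submatrix, star_eq_conjTranspose, conjTranspose_kronecker]

theorem idTensor_injective : Function.Injective (idTensor (m := m)) := fun U V h => by
  ext x y
  simpa [idTensor_cons] using congr_fun₂ h (Fin.cons 0 x) (Fin.cons 0 y)

theorem idTensorHom_injective (m : ℕ) : Function.Injective (idTensorHom m) := fun _ _ h =>
  Subtype.ext (idTensor_injective (congr_arg Subtype.val h))

theorem gateOn_zero_mul_apply (u : Matrix.unitaryGroup (Fin 2) ℂ) (W : QUnitary (m + 1))
    (a : Fin 2) (x : Fin m → Fin 2) (y : Fin (m + 1) → Fin 2) :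
    (gateOn 0 u * W : QUnitary (m + 1)).1 (Fin.cons a x) y =
      ∑ c, u.1 a c * W.1 (Fin.cons c x) y := by
  simp [← consTensor_one_right, mul_apply, sum_fin_cons, coe_consTensor_apply, one_apply]

theorem mul_gateOn_zero_apply (u : Matrix.unitaryGroup (Fin 2) ℂ) (W : QUnitary (m + 1))
    (b : Fin 2) (x : Fin (m + 1) → Fin 2) (y : Fin m → Fin 2) :
    (W * gateOn 0 u : QUnitary (m + 1)).1 x (Fin.cons b y) =
      ∑ c, W.1 x (Fin.cons c y) * u.1 c b := by
  simp [← consTensor_one_right, mul_apply, sum_fin_cons, coe_consTensor_apply, one_apply]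

theorem idTensor_of_cons_zero {W : QUnitary (m + 1)}
    (hX : Commute W (gateOn 0 matX)) (hZ : Commute W (gateOn 0 matZ)) :
    idTensor (of fun x y => W.1 (Fin.cons 0 x) (Fin.cons 0 y)) = W.1 := by
  ext x y
  obtain ⟨a, x, rfl⟩ : ∃ a x', x = Fin.cons a x' := ⟨_, _, (Fin.cons_self_tail x).symm⟩
  obtain ⟨b, y, rfl⟩ : ∃ b y', y = Fin.cons b y' := ⟨_, _, (Fin.cons_self_tail y).symm⟩
  have hx := congr_fun₂ (congr_arg Subtype.val hX.eq) (Fin.cons 0 x) (Fin.cons 1 y)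
  have hz (a b) := congr_fun₂ (congr_arg Subtype.val hZ.eq) (Fin.cons a x) (Fin.cons b y)
  simp only [gateOn_zero_mul_apply, mul_gateOn_zero_apply, Fin.sum_univ_two] at hx hz
  have h11 : W.1 (Fin.cons 0 x) (Fin.cons 0 y) = W.1 (Fin.cons 1 x) (Fin.cons 1 y) := by
    simpa [matX] using hx
  have h01 : W.1 (Fin.cons 0 x) (Fin.cons 1 y) = 0 :=
    self_eq_neg.mp (by simpa [matZ] using (hz 0 1).symm)
  have h10 : W.1 (Fin.cons 1 x) (Fin.cons 0 y) = 0 :=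
    self_eq_neg.mp (by simpa [matZ] using hz 1 0)
  rw [idTensor_cons, of_apply]
  fin_cases a <;> fin_cases b <;> simp [h11, h01, h10]

theorem mem_range_idTensorHom {W : QUnitary (m + 1)} (hX : Commute W (gateOn 0 matX))
    (hZ : Commute W (gateOn 0 matZ)) : W ∈ (idTensorHom m).range := by
  have hW := idTensor_of_cons_zero hX hZ
  have hunitary : (of fun x y => W.1 (Fin.cons 0 x) (Fin.cons 0 y)) ∈
      unitaryGroup (Fin m → Fin 2) ℂ := by
    rw [mem_unitaryGroup_iff]
    apply idTensor_injective
    rw [idTensor_mul, ← star_idTensor, hW, mem_unitaryGroup_iff.mp W.2, idTensor_one]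
  exact ⟨⟨_, hunitary⟩, Subtype.ext hW⟩

/-! ### The Pauli group and the embedding of Clifford groups -/

theorem consTensor_eq_mul (u : Matrix.unitaryGroup (Fin 2) ℂ) (Q : QUnitary m) :
    consTensor m (u, Q) = gateOn 0 u * idTensorHom m Q := by
  rw [← consTensor_one_right, idTensorHom, MonoidHom.comp_apply, MonoidHom.inr_apply, ← map_mul]
  simp

theorem commute_gateOn_zero_idTensorHom (u : Matrix.unitaryGroup (Fin 2) ℂ)
    (Q : QUnitary m) : Commute (gateOn 0 u) (idTensorHom m Q) := by
  rw [← consTensor_one_right]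
  exact (MonoidHom.commute_inl_inr u Q).map (consTensor m)

theorem idTensorHom_scalarI : idTensorHom m (scalarI hω m) = scalarI hω (m + 1) :=
  Subtype.ext <| by rw [coe_idTensorHom, scalarI, idTensor_smul, idTensor_one]; rfl

theorem scalarI_sq : scalarI hω n * scalarI hω n = -1 :=
  Subtype.ext <| by
    simp [scalarI, smul_smul, ← pow_add, root_pow_four hω, Unitary.coe_neg]

theorem neg_mem_pauliGroup {P : QUnitary n} (hP : P ∈ pauliGroup hω n) :
    -P ∈ pauliGroup hω n := by
  rw [← neg_one_mul, ← scalarI_sq (hω := hω)]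
  exact mul_mem (mul_mem (scalarI_mem hω n) (scalarI_mem hω n)) hP

theorem matX_sq : matX * matX = 1 := by
  ext i j
  fin_cases i <;> fin_cases j <;> simp [matX]

theorem matZ_sq : matZ * matZ = 1 := by
  ext i j
  fin_cases i <;> fin_cases j <;> simp [matZ]

theorem matZ_mul_matX : matZ * matX = -(matX * matZ) := by
  ext i j
  fin_cases i <;> fin_cases j <;> simp [matX, matZ, Unitary.coe_neg]

/-- The subgroup generated by `X` and `Z` in `U(2)`. It omits the scalar `ω² I`, so that its only
scalars are `± I` (whereas `pauliGroup hω 1` contains `ω² I`). -/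
def onePauli : Subgroup (Matrix.unitaryGroup (Fin 2) ℂ) :=
  Subgroup.closure {matX, matZ}

theorem exists_eq_or_eq_neg_of_mem_onePauli {u : Matrix.unitaryGroup (Fin 2) ℂ}
    (hu : u ∈ onePauli) :
    ∃ v ∈ ({1, matX, matZ, matX * matZ} : Set (Matrix.unitaryGroup (Fin 2) ℂ)),
      u = v ∨ u = -v := by
  have hX : matX⁻¹ = matX := inv_eq_of_mul_eq_one_left matX_sq
  have hZ : matZ⁻¹ = matZ := inv_eq_of_mul_eq_one_left matZ_sq
  have hXX (v) : matX * (matX * v) = v := by rw [← mul_assoc, matX_sq, one_mul]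
  have hZZ : matZ * (matX * matZ) = -matX := by
    rw [← mul_assoc, matZ_mul_matX, neg_mul, mul_assoc, matZ_sq, mul_one]
  have mul_mem' {x y} (hx : x ∈ ({matX, matZ} : Set (Matrix.unitaryGroup (Fin 2) ℂ)))
      (hy : ∃ v ∈ ({1, matX, matZ, matX * matZ} : Set (Matrix.unitaryGroup (Fin 2) ℂ)),
        y = v ∨ y = -v) :
      ∃ v ∈ ({1, matX, matZ, matX * matZ} : Set (Matrix.unitaryGroup (Fin 2) ℂ)),
        x * y = v ∨ x * y = -v := by
    obtain ⟨v, rfl | rfl | rfl | rfl, rfl | rfl⟩ := hy <;> obtain rfl | rfl := hx <;>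
      simp [hXX, hZZ, matX_sq, matZ_sq, matZ_mul_matX]
  induction hu using Subgroup.closure_induction_left with
  | one => exact ⟨1, by simp⟩
  | mul_left x hx y _ ih => exact mul_mem' hx ih
  | inv_mul_cancel x hx y _ ih =>
    rw [show x⁻¹ = x by obtain rfl | rfl := hx <;> assumption]
    exact mul_mem' hx ih

theorem eq_one_or_eq_neg_one_of_mem_onePauli {u : Matrix.unitaryGroup (Fin 2) ℂ}
    (hu : u ∈ onePauli) {c : ℂ} (hc : (u : Matrix (Fin 2) (Fin 2) ℂ) = c • 1) :
    u = 1 ∨ u = -1 := by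
  obtain ⟨v, hv, huv⟩ := exists_eq_or_eq_neg_of_mem_onePauli hu
  obtain ⟨d, hd⟩ : ∃ d : ℂ, (v : Matrix (Fin 2) (Fin 2) ℂ) = d • 1 := by
    obtain rfl | rfl := huv
    · exact ⟨c, hc⟩
    · exact ⟨-c, by rw [neg_smul, ← hc, Unitary.coe_neg, neg_neg]⟩
  have hv01 : v.1 0 1 = 0 := by simp [hd]
  have hv11 : v.1 0 0 = v.1 1 1 := by simp [hd]
  obtain rfl | rfl | rfl | rfl := hv
  · exact huv
  · simp [matX] at hv01
  · norm_num [matZ] at hv11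
  · simp [matX, matZ] at hv01

theorem pauliGroup_le_iff {K : Subgroup (QUnitary n)} :
    pauliGroup hω n ≤ K ↔
      (∀ i, gateOn i matX ∈ K) ∧ (∀ i, gateOn i matZ ∈ K) ∧ scalarI hω n ∈ K := by
  simp only [pauliGroup, Subgroup.closure_le, Set.union_subset_iff, Set.range_subset_iff,
    Set.singleton_subset_iff, SetLike.mem_coe, and_assoc]

theorem onePauli_le_iff {K : Subgroup (Matrix.unitaryGroup (Fin 2) ℂ)} :
    onePauli ≤ K ↔ matX ∈ K ∧ matZ ∈ K := by
  simp only [onePauli, Subgroup.closure_le, Set.insert_subset_iff, Set.singleton_subset_iff,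
    SetLike.mem_coe]

theorem pauliGroup_succ :
    pauliGroup hω (m + 1) = (onePauli.prod (pauliGroup hω m)).map (consTensor m) := by
  apply le_antisymm
  · obtain ⟨hX, hZ⟩ := onePauli_le_iff.mp le_rfl
    have left {u} (hu : u ∈ onePauli) :
        gateOn 0 u ∈ (onePauli.prod (pauliGroup hω m)).map (consTensor m) :=
      ⟨(u, 1), ⟨hu, one_mem _⟩, consTensor_one_right u⟩
    have right {Q} (hQ : Q ∈ pauliGroup hω m) :
        idTensorHom m Q ∈ (onePauli.prod (pauliGroup hω m)).map (consTensor m) :=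
      ⟨(1, Q), ⟨one_mem _, hQ⟩, rfl⟩
    refine pauliGroup_le_iff.mpr ⟨Fin.forall_fin_succ.mpr ⟨left hX, fun i => ?_⟩,
      Fin.forall_fin_succ.mpr ⟨left hZ, fun i => ?_⟩, ?_⟩
    · exact idTensorHom_gateOn i matX ▸ right (X_mem hω i)
    · exact idTensorHom_gateOn i matZ ▸ right (Z_mem hω i)
    · exact idTensorHom_scalarI (hω := hω) ▸ right (scalarI_mem hω m)
  · rw [Subgroup.map_le_iff_le_comap, Subgroup.prod_le_iff]
    simp only [Subgroup.map_le_iff_le_comap, onePauli_le_iff, pauliGroup_le_iff,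
      Subgroup.mem_comap]
    change (consTensor m (_, 1) ∈ _ ∧ consTensor m (_, 1) ∈ _) ∧
      (∀ i, idTensorHom m _ ∈ _) ∧ (∀ i, idTensorHom m _ ∈ _) ∧ idTensorHom m _ ∈ _
    simp only [consTensor_one_right, idTensorHom_gateOn, idTensorHom_scalarI]
    exact ⟨⟨X_mem hω 0, Z_mem hω 0⟩, fun i => X_mem hω i.succ, fun i => Z_mem hω i.succ,
      scalarI_mem hω (m + 1)⟩

theorem consTensor_neg_left (u : Matrix.unitaryGroup (Fin 2) ℂ) (Q : QUnitary m) :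
    consTensor m (-u, Q) = consTensor m (u, -Q) := by
  ext x y
  simp [coe_consTensor_apply, Unitary.coe_neg]

theorem exists_eq_smul_one_of_consTensor_eq_idTensorHom
    {u : Matrix.unitaryGroup (Fin 2) ℂ} {Q V : QUnitary m}
    (h : consTensor m (u, Q) = idTensorHom m V) :
    ∃ c : ℂ, (u : Matrix (Fin 2) (Fin 2) ℂ) = c • 1 := by
  refine exists_eq_smul_one_of_kronecker_eq (Unitary.isUnit_coe (U := Q)).ne_zero
    (C := (V : QMatrix m)) ?_
  ext ⟨a, x⟩ ⟨b, y⟩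
  exact congr_fun₂ (congr_arg Subtype.val h) (Fin.cons a x) (Fin.cons b y)

theorem comap_idTensorHom_pauliGroup :
    (pauliGroup hω (m + 1)).comap (idTensorHom m) = pauliGroup hω m := by
  rw [pauliGroup_succ]
  ext V
  constructor
  · rintro ⟨⟨u, Q⟩, ⟨hu, hQ⟩, h⟩
    obtain ⟨c, hc⟩ := exists_eq_smul_one_of_consTensor_eq_idTensorHom h
    obtain rfl | rfl := eq_one_or_eq_neg_one_of_mem_onePauli hu hc
    · exact idTensorHom_injective m h ▸ hQ
    · rw [consTensor_neg_left] at h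
      exact idTensorHom_injective m h ▸ neg_mem_pauliGroup hQ
  · exact fun hV => ⟨(1, V), ⟨one_mem _, hV⟩, rfl⟩

theorem idTensorHom_mem_cliffordGroup_iff {U : QUnitary m} :
    idTensorHom m U ∈ cliffordGroup hω (m + 1) ↔ U ∈ cliffordGroup hω m := by
  constructor
  · intro h
    rw [cliffordGroup, ← comap_idTensorHom_pauliGroup]
    exact Subgroup.le_normalizer_comap (idTensorHom m) h
  · intro h
    rw [cliffordGroup, Subgroup.mem_normalizer_iff] at h
    rw [cliffordGroup, pauliGroup_succ]
    refine Subgroup.le_normalizer_map _ (Subgroup.mem_map_of_mem (consTensor m) (x := (1, U)) ?_)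
    rw [Subgroup.mem_normalizer_iff]
    rintro ⟨u, Q⟩
    simp [Subgroup.mem_prod, ← h]

/-- The homomorphism `U ↦ I₂ ⊗ U` of Clifford groups. -/
def cliffordEmb {ω : ℂ} (hω : IsPrimitiveRoot ω 8) (m : ℕ) :
    cliffordGroup hω m →* cliffordGroup hω (m + 1) :=
  ((idTensorHom m).comp (cliffordGroup hω m).subtype).codRestrict _
    fun U => idTensorHom_mem_cliffordGroup_iff.mpr U.2

theorem coe_cliffordEmb (U : cliffordGroup hω m) :
    ((cliffordEmb hω m U : QUnitary (m + 1)) : QMatrix (m + 1)) =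
      idTensor ((U : QUnitary m) : QMatrix m) :=
  rfl

/-- The homomorphism `[U] ↦ [I₂ ⊗ U]` of projective Clifford groups. -/
def projEmb {ω : ℂ} (hω : IsPrimitiveRoot ω 8) (m : ℕ) :
    ProjClifford hω m →* ProjClifford hω (m + 1) :=
  QuotientGroup.map _ _ (cliffordEmb hω m) (by
    rintro U ⟨c, hc⟩
    exact ⟨c, by rw [coe_cliffordEmb, hc, idTensor_smul, idTensor_one]⟩)

theorem projEmb_proj (U : cliffordGroup hω m) :
    projEmb hω m (proj hω m U) = proj hω (m + 1) (cliffordEmb hω m U) :=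
  rfl

theorem projEmb_injective (m : ℕ) : Function.Injective (projEmb hω m) := by
  rw [injective_iff_map_eq_one]
  intro g hg
  obtain ⟨U, rfl⟩ := QuotientGroup.mk'_surjective _ g
  obtain ⟨c, hc⟩ := (QuotientGroup.eq_one_iff _).mp hg
  refine (QuotientGroup.eq_one_iff U).mpr ⟨c, idTensor_injective ?_⟩
  rw [← coe_cliffordEmb, hc, idTensor_smul, idTensor_one]

/-! ### Lifts to the Clifford group -/

theorem proj_surjective : Function.Surjective (proj hω n) :=
  QuotientGroup.mk'_surjective _

theorem proj_eq_proj_iff {U V : cliffordGroup hω n} : proj hω n U = proj hω n V ↔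
    ∃ c : ℂ, ((U : QUnitary n) : QMatrix n) = c • ((V : QUnitary n) : QMatrix n) := by
  rw [eq_comm]
  refine QuotientGroup.eq.trans (exists_congr fun c => ?_)
  have hV : star ((V : QUnitary n) : QMatrix n) * ((V : QUnitary n) : QMatrix n) = 1 :=
    mem_unitaryGroup_iff'.mp (V : QUnitary n).2
  have hV' : ((V : QUnitary n) : QMatrix n) * star ((V : QUnitary n) : QMatrix n) = 1 :=
    mem_unitaryGroup_iff.mp (V : QUnitary n).2
  change star ((V : QUnitary n) : QMatrix n) * ((U : QUnitary n) : QMatrix n) = _ ↔ _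
  constructor <;> intro h
  · rw [← one_mul ((U : QUnitary n) : QMatrix n), ← hV', mul_assoc, h, mul_smul_comm, mul_one]
  · rw [h, mul_smul_comm, hV]

instance subsingleton_projClifford_zero : Subsingleton (ProjClifford hω 0) := by
  refine subsingleton_of_forall_eq 1 fun a => ?_
  obtain ⟨U, rfl⟩ := proj_surjective a
  rw [← map_one (proj hω 0), proj_eq_proj_iff]
  refine ⟨U.1.1 default default, ?_⟩
  ext x y
  simp [Subsingleton.elim x default, Subsingleton.elim y default]

theorem semiconjBy_proj_iff {U V W : cliffordGroup hω n} :
    SemiconjBy (proj hω n U) (proj hω n V) (proj hω n W) ↔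
      ∃ c : ℂ, ((U : QUnitary n) * (V : QUnitary n) : QMatrix n) =
        c • ((W : QUnitary n) * (U : QUnitary n) : QMatrix n) := by
  rw [SemiconjBy, ← map_mul, ← map_mul]
  exact proj_eq_proj_iff

theorem semiconjBy_proj {U V W : cliffordGroup hω n}
    (h : (U * V : QUnitary n) = W * U) :
    SemiconjBy (proj hω n U) (proj hω n V) (proj hω n W) :=
  SemiconjBy.map (Subtype.ext h : SemiconjBy U V W) (proj hω n)

theorem globalPhases_le_center : globalPhases hω n ≤ Subgroup.center (cliffordGroup hω n) := by
  rintro U ⟨c, hc⟩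
  refine Subgroup.mem_center_iff.mpr fun V => Subtype.ext (Subtype.ext ?_)
  change (V : QUnitary n).1 * _ = _ * _
  rw [hc, mul_smul_comm, smul_mul_assoc, mul_one, one_mul]

theorem liftsCommute_proj {U V : cliffordGroup hω n} (h : Commute (U : QUnitary n) V) :
    LiftsCommute (proj hω n U) (proj hω n V) :=
  .of_commute globalPhases_le_center (Subtype.ext h)

theorem LiftsCommute.commute_val {U V : cliffordGroup hω n}
    (h : LiftsCommute (proj hω n U) (proj hω n V)) : Commute (U : QUnitary n) V :=
  (h U V rfl rfl).map (cliffordGroup hω n).subtype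

theorem liftsCommute_of_trace_ne_zero {a : ProjClifford hω n} {V : cliffordGroup hω n}
    (hV : ((V : QUnitary n) : QMatrix n).trace ≠ 0) (h : Commute a (proj hω n V)) :
    LiftsCommute a (proj hω n V) := by
  obtain ⟨U, rfl⟩ := proj_surjective a
  obtain ⟨c, hc⟩ := semiconjBy_proj_iff.mp h
  exact liftsCommute_proj (Subtype.ext (commute_of_mul_eq_smul_mul Unitary.isUnit_coe hc hV))

theorem liftsCommute_or_liftsCommute_mul_left {a b : ProjClifford hω n} {X : cliffordGroup hω n}
    (hX : (X : QUnitary n) * X = 1) (ha : Commute a (proj hω n X)) (hb : Commute b (proj hω n X))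
    (hbX : ¬ LiftsCommute b (proj hω n X)) :
    LiftsCommute a (proj hω n X) ∨ LiftsCommute (b * a) (proj hω n X) := by
  obtain ⟨A, rfl⟩ := proj_surjective a
  obtain ⟨B, rfl⟩ := proj_surjective b
  have commute_or_neg (U : cliffordGroup hω n) (h : Commute (proj hω n U) (proj hω n X)) :
      (U * X : QUnitary n) = X * U ∨ (U * X : QUnitary n) = -(X * U) := by
    obtain ⟨c, hc⟩ := semiconjBy_proj_iff.mp h
    exact (mul_eq_mul_or_eq_neg_of_eq_smul (congr_arg Subtype.val hX) hc).imp
      Subtype.ext Subtype.ext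
  have hBX : (B * X : QUnitary n) = -(X * B) :=
    (commute_or_neg B hb).resolve_left fun h => hbX (liftsCommute_proj h)
  refine (commute_or_neg A ha).imp (fun h => liftsCommute_proj h) fun hAX => ?_
  rw [← map_mul]
  refine liftsCommute_proj ?_
  change (B * A * X : QUnitary n) = X * (B * A)
  rw [mul_assoc, hAX, mul_neg, ← mul_assoc, hBX, neg_mul, neg_neg, mul_assoc]

/-! ### Gates and Pauli classes -/

theorem pauliGroup_le_cliffordGroup {ω : ℂ} (hω : IsPrimitiveRoot ω 8) (n : ℕ) :
    pauliGroup hω n ≤ cliffordGroup hω n :=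
  Subgroup.le_normalizer

/-- The image of the Pauli group in the projective Clifford group. -/
def pauliClasses {ω : ℂ} (hω : IsPrimitiveRoot ω 8) (n : ℕ) : Subgroup (ProjClifford hω n) :=
  ((pauliGroup hω n).subgroupOf (cliffordGroup hω n)).map (proj hω n)

/-- The class of the Pauli gate `X` on qubit `i`. -/
def xGate {ω : ℂ} (hω : IsPrimitiveRoot ω 8) {n : ℕ} (i : Fin n) : ProjClifford hω n :=
  proj hω n ⟨gateOn i matX, pauliGroup_le_cliffordGroup hω n (X_mem hω i)⟩

/-- The class of the Pauli gate `Z` on qubit `i`. -/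
def zGate {ω : ℂ} (hω : IsPrimitiveRoot ω 8) {n : ℕ} (i : Fin n) : ProjClifford hω n :=
  proj hω n ⟨gateOn i matZ, pauliGroup_le_cliffordGroup hω n (Z_mem hω i)⟩

instance pauliClasses_normal : (pauliClasses hω n).Normal :=
  Subgroup.normal_in_normalizer.map _ proj_surjective

theorem xGate_mem_pauliClasses (i : Fin n) : xGate hω i ∈ pauliClasses hω n :=
  ⟨_, X_mem hω i, rfl⟩

theorem zGate_mem_pauliClasses (i : Fin n) : zGate hω i ∈ pauliClasses hω n :=
  ⟨_, Z_mem hω i, rfl⟩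

theorem mem_pauliClasses_of_semiconjBy {g p q : ProjClifford hω n} (hp : p ∈ pauliClasses hω n)
    (h : SemiconjBy g p q) : q ∈ pauliClasses hω n := by
  rw [← mul_inv_eq_iff_eq_mul.mpr h.eq]
  exact pauliClasses_normal.conj_mem p hp g

theorem proj_gateOn_mul_self (i : Fin n) {u : Matrix.unitaryGroup (Fin 2) ℂ} (hu : u * u = 1)
    (h : gateOn i u ∈ cliffordGroup hω n) : proj hω n ⟨_, h⟩ * proj hω n ⟨_, h⟩ = 1 := by
  rw [← map_mul, ← map_one (proj hω n)]
  exact congr_arg _ (Subtype.ext ((gateOn_mul i u u).trans (hu ▸ gateOn_one i)))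

theorem hGate_mul_self (i : Fin n) : hGate hω i * hGate hω i = 1 :=
  proj_gateOn_mul_self i matH_sq _

theorem zGate_mul_self (i : Fin n) : zGate hω i * zGate hω i = 1 :=
  proj_gateOn_mul_self i matZ_sq _

theorem matS_sq : matS hω * matS hω = matZ := by
  have := root_pow_four hω
  ext i j
  fin_cases i <;> fin_cases j <;> simp [matS, matZ, ← pow_add, this]

theorem sGate_mul_self (i : Fin n) : sGate hω i * sGate hω i = zGate hω i :=
  congr_arg (proj hω n) (Subtype.ext ((gateOn_mul i _ _).trans (by rw [matS_sq])))

theorem semiconjBy_hGate_xGate (i : Fin n) :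
    SemiconjBy (hGate hω i) (xGate hω i) (zGate hω i) :=
  semiconjBy_proj (by rw [gateOn_mul, gateOn_mul, matH_X])

theorem semiconjBy_hGate_zGate (i : Fin n) :
    SemiconjBy (hGate hω i) (zGate hω i) (xGate hω i) :=
  semiconjBy_proj (by rw [gateOn_mul, gateOn_mul, matH_Z])

theorem semiconjBy_sGate_xGate (i : Fin n) :
    SemiconjBy (sGate hω i) (xGate hω i) (xGate hω i * zGate hω i) := by
  rw [xGate, zGate, ← map_mul]
  refine semiconjBy_proj_iff.mpr ⟨ω ^ 2, ?_⟩
  change onQubit i _ * onQubit i _ = _ • (onQubit i _ * onQubit i _ * onQubit i _)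
  rw [onQubit_mul, onQubit_mul, onQubit_mul, ← onQubit_smul]
  exact congr_arg (onQubit i) (matS_X hω)

theorem commute_sGate_zGate (i : Fin n) : Commute (sGate hω i) (zGate hω i) :=
  semiconjBy_proj (by rw [gateOn_mul, gateOn_mul, matS_Z])

theorem hGate_sGate_hGate_mul_self (i : Fin n) : hGate hω i * sGate hω i * hGate hω i *
    (hGate hω i * sGate hω i * hGate hω i) = xGate hω i := calc
  _ = hGate hω i * (sGate hω i * (hGate hω i * hGate hω i) * sGate hω i) * hGate hω i := by
    simp only [mul_assoc]
  _ = hGate hω i * zGate hω i * hGate hω i := by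
    rw [hGate_mul_self, mul_one, sGate_mul_self]
  _ = xGate hω i := by
    rw [(semiconjBy_hGate_zGate i).eq, mul_assoc, hGate_mul_self, mul_one]

theorem semiconjBy_lamGate_xGate_castSucc (i : Fin m) : SemiconjBy (lamGate hω i)
    (xGate hω i.castSucc) (xGate hω i.castSucc * zGate hω i.succ) :=
  semiconjBy_proj (gateCZ_X_left i)

theorem semiconjBy_lamGate_xGate_succ (i : Fin m) : SemiconjBy (lamGate hω i)
    (xGate hω i.succ) (xGate hω i.succ * zGate hω i.castSucc) :=
  semiconjBy_proj (gateCZ_X_right i)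

theorem commute_lamGate_zGate (i : Fin m) (j : Fin (m + 1)) :
    Commute (lamGate hω i) (zGate hω j) :=
  semiconjBy_proj (gateCZ_Z i j)

theorem gateOn_neg (i : Fin n) (u : Matrix.unitaryGroup (Fin 2) ℂ) :
    gateOn i (-u) = -gateOn i u :=
  Subtype.ext <| by
    rw [Unitary.coe_neg, ← neg_one_smul ℂ ((gateOn i u : QUnitary n) : QMatrix n)]
    exact (congr_arg (onQubit i) (neg_one_smul ℂ u.1).symm).trans (onQubit_smul i (-1) u.1)

theorem gateOn_matZ_mul_gateOn_matX (i : Fin n) :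
    gateOn i matZ * gateOn i matX = -(gateOn i matX * gateOn i matZ) := by
  rw [gateOn_mul, gateOn_mul, matZ_mul_matX, gateOn_neg]

theorem commute_xGate_zGate (i : Fin n) : Commute (xGate hω i) (zGate hω i) :=
  .symm <| semiconjBy_proj_iff.mpr ⟨-1, by
    rw [neg_one_smul]; exact congr_arg Subtype.val (gateOn_matZ_mul_gateOn_matX i)⟩

theorem projEmb_xGate (i : Fin m) : projEmb hω m (xGate hω i) = xGate hω i.succ :=
  congr_arg (proj hω _) (Subtype.ext (idTensorHom_gateOn i matX))

theorem projEmb_zGate (i : Fin m) : projEmb hω m (zGate hω i) = zGate hω i.succ :=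
  congr_arg (proj hω _) (Subtype.ext (idTensorHom_gateOn i matZ))

theorem projEmb_hGate (i : Fin m) : projEmb hω m (hGate hω i) = hGate hω i.succ :=
  congr_arg (proj hω _) (Subtype.ext (idTensorHom_gateOn i matH))

theorem projEmb_sGate (i : Fin m) : projEmb hω m (sGate hω i) = sGate hω i.succ :=
  congr_arg (proj hω _) (Subtype.ext (idTensorHom_gateOn i (matS hω)))

theorem projEmb_lamGate (i : Fin m) : projEmb hω (m + 1) (lamGate hω i) = lamGate hω i.succ :=
  congr_arg (proj hω _) (Subtype.ext (idTensorHom_gateCZ i))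

theorem commute_proj_gateOn_zero_projEmb {u} (hu : gateOn 0 u ∈ cliffordGroup hω (m + 1))
    (g : ProjClifford hω m) : Commute (proj hω (m + 1) ⟨gateOn 0 u, hu⟩) (projEmb hω m g) := by
  obtain ⟨U, rfl⟩ := proj_surjective g
  exact semiconjBy_proj (commute_gateOn_zero_idTensorHom u U.1)

theorem liftsCommute_xGate_projEmb (g : ProjClifford hω m) :
    LiftsCommute (xGate hω 0) (projEmb hω m g) := by
  obtain ⟨U, rfl⟩ := proj_surjective g
  exact liftsCommute_proj (commute_gateOn_zero_idTensorHom matX U.1)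

theorem liftsCommute_xGate_self (i : Fin n) : LiftsCommute (xGate hω i) (xGate hω i) :=
  liftsCommute_proj (Commute.refl _)

theorem not_liftsCommute_zGate_xGate (i : Fin n) : ¬ LiftsCommute (zGate hω i) (xGate hω i) := by
  intro h
  have hneg : gateOn i matX * gateOn i matZ = -(gateOn i matX * gateOn i matZ) :=
    h.commute_val.eq.symm.trans (gateOn_matZ_mul_gateOn_matX i)
  have htwo : (2 : ℂ) • (gateOn i matX * gateOn i matZ).1 = 0 := by
    rw [two_smul]
    exact eq_neg_iff_add_eq_zero.mp (congr_arg Subtype.val hneg)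
  exact Unitary.isUnit_coe.ne_zero ((smul_eq_zero.mp htwo).resolve_left two_ne_zero)

theorem xGate_ne_one (i : Fin m) : xGate hω i ≠ 1 := fun h =>
  not_liftsCommute_zGate_xGate (hω := hω) i <| by
    rw [h, ← map_one (proj hω m)]
    exact liftsCommute_proj (Commute.one_right _)

theorem liftsCommute_xGate_or_zGate_mul {a : ProjClifford hω n} {i : Fin n}
    (h : Commute a (xGate hω i)) :
    LiftsCommute a (xGate hω i) ∨ LiftsCommute (zGate hω i * a) (xGate hω i) :=
  liftsCommute_or_liftsCommute_mul_left ((gateOn_mul i _ _).trans (matX_sq ▸ gateOn_one i)) h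
    (commute_xGate_zGate i).symm (not_liftsCommute_zGate_xGate i)

theorem liftsCommute_zGate_or_xGate_mul {a : ProjClifford hω n} {i : Fin n}
    (h : Commute a (zGate hω i)) :
    LiftsCommute a (zGate hω i) ∨ LiftsCommute (xGate hω i * a) (zGate hω i) :=
  liftsCommute_or_liftsCommute_mul_left ((gateOn_mul i _ _).trans (matZ_sq ▸ gateOn_one i)) h
    (commute_xGate_zGate i) fun hxz => not_liftsCommute_zGate_xGate i hxz.symm

theorem exists_eq_mul_projEmb_of_mem_pauliClasses {p : ProjClifford hω (m + 1)}
    (hp : p ∈ pauliClasses hω (m + 1)) :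
    ∃ a ∈ ({1, xGate hω 0, zGate hω 0, xGate hω 0 * zGate hω 0} : Set (ProjClifford hω (m + 1))),
      ∃ q ∈ pauliClasses hω m, p = a * projEmb hω m q := by
  obtain ⟨⟨P, hPC⟩, hP, rfl⟩ := hp
  obtain ⟨⟨u, Q⟩, ⟨hu, hQ⟩, huQ⟩ : P ∈ (onePauli.prod (pauliGroup hω m)).map (consTensor m) :=
    pauliGroup_succ (hω := hω) ▸ hP
  obtain ⟨v, hv, huv⟩ := exists_eq_or_eq_neg_of_mem_onePauli hu
  set q := proj hω m ⟨Q, pauliGroup_le_cliffordGroup hω m hQ⟩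
  have eq_mul_projEmb {a : ProjClifford hω (m + 1)} (V : cliffordGroup hω (m + 1))
      (hV : V.1 = gateOn 0 v) (ha : proj hω (m + 1) V = a) :
      proj hω (m + 1) ⟨P, hPC⟩ = a * projEmb hω m q := by
    rw [← ha, projEmb_proj, ← map_mul, proj_eq_proj_iff]
    change ∃ c : ℂ, P.1 = c • (V.1 * idTensorHom m Q).1
    rw [← huQ, consTensor_eq_mul, hV]
    obtain rfl | rfl := huv
    · exact ⟨1, (one_smul _ _).symm⟩
    · exact ⟨-1, by rw [gateOn_neg, neg_mul, neg_one_smul, Unitary.coe_neg]⟩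
  have hq : q ∈ pauliClasses hω m := ⟨_, hQ, rfl⟩
  obtain rfl | rfl | rfl | rfl := hv
  · exact ⟨1, by simp, q, hq, eq_mul_projEmb 1 (gateOn_one 0).symm (map_one _)⟩
  · exact ⟨xGate hω 0, by simp, q, hq, eq_mul_projEmb _ rfl rfl⟩
  · exact ⟨zGate hω 0, by simp, q, hq, eq_mul_projEmb _ rfl rfl⟩
  · let X : cliffordGroup hω (m + 1) := ⟨_, pauliGroup_le_cliffordGroup hω _ (X_mem hω 0)⟩
    let Z : cliffordGroup hω (m + 1) := ⟨_, pauliGroup_le_cliffordGroup hω _ (Z_mem hω 0)⟩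
    exact ⟨xGate hω 0 * zGate hω 0, by simp, q, hq,
      eq_mul_projEmb (X * Z) (gateOn_mul 0 _ _) (map_mul _ X Z)⟩

theorem mem_range_projEmb {g : ProjClifford hω (m + 1)} (hx : LiftsCommute g (xGate hω 0))
    (hz : LiftsCommute g (zGate hω 0)) : g ∈ (projEmb hω m).range := by
  obtain ⟨W, rfl⟩ := proj_surjective g
  obtain ⟨V, hV⟩ := mem_range_idTensorHom hx.commute_val hz.commute_val
  have hVC : V ∈ cliffordGroup hω m := idTensorHom_mem_cliffordGroup_iff.mp (hV ▸ W.2)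
  exact ⟨proj hω m ⟨V, hVC⟩, congr_arg (proj hω (m + 1)) (Subtype.ext hV)⟩

/-! ### Generation by gates -/

/-- The subgroup of the projective Clifford group on `m + 1` qubits generated by the classes of the
Hadamard, phase and controlled `Z` gates. -/
def gateGroup {ω : ℂ} (hω : IsPrimitiveRoot ω 8) (m : ℕ) : Subgroup (ProjClifford hω (m + 1)) :=
  Subgroup.closure
    (Set.range (hGate hω) ∪ Set.range (sGate hω) ∪ Set.range (lamGate hω))

/-- The elements of `gateGroup` that fix the class of `X_0` under conjugation. -/
def xStabilizer {ω : ℂ} (hω : IsPrimitiveRoot ω 8) (m : ℕ) :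
    Subgroup (ProjClifford hω (m + 1)) :=
  gateGroup hω m ⊓ Subgroup.centralizer {xGate hω 0}

theorem hGate_mem_gateGroup (i : Fin (m + 1)) : hGate hω i ∈ gateGroup hω m :=
  Subgroup.subset_closure (.inl (.inl ⟨i, rfl⟩))

theorem sGate_mem_gateGroup (i : Fin (m + 1)) : sGate hω i ∈ gateGroup hω m :=
  Subgroup.subset_closure (.inl (.inr ⟨i, rfl⟩))

theorem lamGate_mem_gateGroup (i : Fin m) : lamGate hω i ∈ gateGroup hω m :=
  Subgroup.subset_closure (.inr ⟨i, rfl⟩)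

theorem hGate_sGate_hGate_mem_gateGroup (i : Fin (m + 1)) :
    hGate hω i * sGate hω i * hGate hω i ∈ gateGroup hω m :=
  mul_mem (mul_mem (hGate_mem_gateGroup i) (sGate_mem_gateGroup i)) (hGate_mem_gateGroup i)

theorem zGate_mem_gateGroup (i : Fin (m + 1)) : zGate hω i ∈ gateGroup hω m :=
  sGate_mul_self (hω := hω) i ▸ mul_mem (sGate_mem_gateGroup i) (sGate_mem_gateGroup i)

theorem xGate_mem_gateGroup (i : Fin (m + 1)) : xGate hω i ∈ gateGroup hω m :=
  hGate_sGate_hGate_mul_self (hω := hω) i ▸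
    mul_mem (hGate_sGate_hGate_mem_gateGroup i) (hGate_sGate_hGate_mem_gateGroup i)

theorem map_projEmb_gateGroup : (gateGroup hω m).map (projEmb hω (m + 1)) =
    Subgroup.closure
      ({g | ∃ i : Fin (m + 2), i ≠ 0 ∧ g = hGate hω i} ∪
        {g | ∃ i : Fin (m + 2), i ≠ 0 ∧ g = sGate hω i} ∪
        {g | ∃ j : Fin (m + 1), (j : ℕ) ≠ 0 ∧ g = lamGate hω j}) := by
  have image_range {k : ℕ} {f : Fin k → ProjClifford hω (m + 1)}
      {f' : Fin (k + 1) → ProjClifford hω (m + 2)}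
      (h : ∀ i, projEmb hω (m + 1) (f i) = f' i.succ) :
      projEmb hω (m + 1) '' Set.range f = {g | ∃ i, i ≠ 0 ∧ g = f' i} := by
    ext g
    simp [Fin.exists_fin_succ, h, eq_comm]
  have image_lamGate : projEmb hω (m + 1) '' Set.range (lamGate hω) =
      {g | ∃ j : Fin (m + 1), (j : ℕ) ≠ 0 ∧ g = lamGate hω j} := by
    simpa only [Fin.val_ne_zero_iff] using image_range projEmb_lamGate
  rw [gateGroup, MonoidHom.map_closure, Set.image_union, Set.image_union,
    image_range projEmb_hGate, image_range projEmb_sGate, image_lamGate]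

theorem projEmb_mem_gateGroup {g : ProjClifford hω (m + 1)} (hg : g ∈ gateGroup hω m) :
    projEmb hω (m + 1) g ∈ gateGroup hω (m + 1) := by
  have hg' := Subgroup.mem_map_of_mem (projEmb hω (m + 1)) hg
  rw [map_projEmb_gateGroup] at hg'
  refine (Subgroup.closure_le _).mpr ?_ hg'
  rintro _ ((⟨i, -, rfl⟩ | ⟨i, -, rfl⟩) | ⟨j, -, rfl⟩)
  exacts [hGate_mem_gateGroup i, sGate_mem_gateGroup i, lamGate_mem_gateGroup j]

theorem xStabilizer_le_gateGroup : xStabilizer hω m ≤ gateGroup hω m :=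
  inf_le_left

theorem mem_xStabilizer {g : ProjClifford hω (m + 1)} :
    g ∈ xStabilizer hω m ↔ g ∈ gateGroup hω m ∧ Commute g (xGate hω 0) := by
  rw [xStabilizer, Subgroup.mem_inf, Subgroup.mem_centralizer_singleton_iff]
  rfl

theorem commute_xGate_projEmb (g : ProjClifford hω m) :
    Commute (xGate hω 0) (projEmb hω m g) :=
  commute_proj_gateOn_zero_projEmb _ g

theorem commute_zGate_projEmb (g : ProjClifford hω m) :
    Commute (zGate hω 0) (projEmb hω m g) :=
  commute_proj_gateOn_zero_projEmb _ g

theorem commute_hGate_projEmb (g : ProjClifford hω m) :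
    Commute (hGate hω 0) (projEmb hω m g) :=
  commute_proj_gateOn_zero_projEmb _ g

theorem commute_sGate_projEmb (g : ProjClifford hω m) :
    Commute (sGate hω 0) (projEmb hω m g) :=
  commute_proj_gateOn_zero_projEmb _ g

theorem commute_hGate_sGate_hGate_projEmb (g : ProjClifford hω m) :
    Commute (hGate hω 0 * sGate hω 0 * hGate hω 0) (projEmb hω m g) :=
  ((commute_hGate_projEmb g).mul_left (commute_sGate_projEmb g)).mul_left (commute_hGate_projEmb g)

theorem commute_projEmb_of_mem {a : ProjClifford hω (m + 1)}
    (ha : a ∈ ({1, xGate hω 0, zGate hω 0, xGate hω 0 * zGate hω 0} : Set _))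
    (g : ProjClifford hω m) : Commute a (projEmb hω m g) := by
  obtain rfl | rfl | rfl | rfl := ha
  exacts [.one_left _, commute_xGate_projEmb g, commute_zGate_projEmb g,
    (commute_xGate_projEmb g).mul_left (commute_zGate_projEmb g)]

theorem semiconjBy_hGate_sGate_hGate_zGate (i : Fin m) :
    SemiconjBy (hGate hω i * sGate hω i * hGate hω i) (zGate hω i) (xGate hω i * zGate hω i) := by
  have h := (semiconjBy_hGate_xGate (hω := hω) i).mul_right (semiconjBy_hGate_zGate i)
  rw [← (commute_xGate_zGate i).eq] at h
  exact (h.mul_left (semiconjBy_sGate_xGate i)).mul_left (semiconjBy_hGate_zGate i)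

theorem commute_hGate_sGate_hGate_xGate (i : Fin m) :
    Commute (hGate hω i * sGate hω i * hGate hω i) (xGate hω i) :=
  ((semiconjBy_hGate_zGate i).mul_left (commute_sGate_zGate i)).mul_left (semiconjBy_hGate_xGate i)

theorem isConjIn_xStabilizer_xGate_mul_zGate (q : ProjClifford hω m) :
    IsConjIn (xStabilizer hω m) (xGate hω 0 * zGate hω 0 * projEmb hω m q)
      (zGate hω 0 * projEmb hω m q) :=
  .symm ⟨_, mem_xStabilizer.mpr ⟨hGate_sGate_hGate_mem_gateGroup 0,
    commute_hGate_sGate_hGate_xGate 0⟩,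
    (semiconjBy_hGate_sGate_hGate_zGate 0).mul_right (commute_hGate_sGate_hGate_projEmb q)⟩

theorem isConjIn_xStabilizer_zGate_mul_projEmb_xGate :
    IsConjIn (xStabilizer hω (m + 1)) (zGate hω 0 * projEmb hω (m + 1) (xGate hω 0))
      (zGate hω 0) := by
  set E := projEmb hω (m + 1)
  have hxz := semiconjBy_hGate_xGate (hω := hω) (0 : Fin (m + 2))
  have hzx := semiconjBy_hGate_zGate (hω := hω) (0 : Fin (m + 2))
  have lam_xz : SemiconjBy (lamGate hω 0) (xGate hω 0 * E (zGate hω 0)) (xGate hω 0) := by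
    have h := (semiconjBy_lamGate_xGate_castSucc (hω := hω) (0 : Fin (m + 1))).mul_right
      (commute_lamGate_zGate 0 (Fin.succ 0))
    rw [mul_assoc, zGate_mul_self, mul_one, ← projEmb_zGate] at h
    exact h
  -- The factors, from right to left, send `z₀x₁ ↦ z₀z₁ ↦ x₀z₁ ↦ x₀ ↦ z₀` and
  -- `x₀ ↦ x₀ ↦ z₀ ↦ z₀ ↦ x₀`.
  refine ⟨hGate hω 0 * (lamGate hω 0 * (hGate hω 0 * E (hGate hω 0))),
    mem_xStabilizer.mpr ⟨?_, ?_⟩, ?_⟩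
  · have hh := hGate_mem_gateGroup (hω := hω) (0 : Fin (m + 2))
    exact mul_mem hh (mul_mem (lamGate_mem_gateGroup 0)
      (mul_mem hh (projEmb_mem_gateGroup (hGate_mem_gateGroup 0))))
  · have hEx : SemiconjBy (E (hGate hω 0)) (xGate hω 0) (xGate hω 0) :=
      (commute_xGate_projEmb _).symm
    have lam_z : SemiconjBy (lamGate hω 0) (zGate hω 0) (zGate hω 0) :=
      commute_lamGate_zGate (0 : Fin (m + 1)) 0
    exact hzx.mul_left (lam_z.mul_left (hxz.mul_left hEx))
  · have hE : SemiconjBy (E (hGate hω 0)) (zGate hω 0 * E (xGate hω 0))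
        (zGate hω 0 * E (zGate hω 0)) :=
      SemiconjBy.mul_right (commute_zGate_projEmb _).symm ((semiconjBy_hGate_xGate 0).map E)
    have hzxE : SemiconjBy (hGate hω 0) (zGate hω 0 * E (zGate hω 0))
        (xGate hω 0 * E (zGate hω 0)) :=
      hzx.mul_right (commute_hGate_projEmb _)
    exact hxz.mul_left (lam_xz.mul_left (hzxE.mul_left hE))

theorem IsConjIn.mul_projEmb {q q' : ProjClifford hω (m + 1)}
    (h : IsConjIn (gateGroup hω m) q q') {a : ProjClifford hω (m + 2)}
    (ha : ∀ g, Commute a (projEmb hω (m + 1) g)) :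
    IsConjIn (xStabilizer hω (m + 1)) (a * projEmb hω (m + 1) q) (a * projEmb hω (m + 1) q') := by
  obtain ⟨g, hg, hq⟩ := h
  exact ⟨projEmb hω (m + 1) g,
    mem_xStabilizer.mpr ⟨projEmb_mem_gateGroup hg, (commute_xGate_projEmb g).symm⟩,
    SemiconjBy.mul_right (ha g).symm (hq.map _)⟩

theorem isConjIn_gateGroup_xGate_mul_projEmb (q : ProjClifford hω m) :
    IsConjIn (gateGroup hω m) (xGate hω 0 * projEmb hω m q) (zGate hω 0 * projEmb hω m q) :=
  ⟨hGate hω 0, hGate_mem_gateGroup 0,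
    (semiconjBy_hGate_xGate 0).mul_right (commute_hGate_projEmb q)⟩

theorem isConjIn_gateGroup_zGate_xGate : IsConjIn (gateGroup hω m) (zGate hω 0) (xGate hω 0) :=
  ⟨hGate hω 0, hGate_mem_gateGroup 0, semiconjBy_hGate_zGate 0⟩

theorem isConjIn_gateGroup_zGate_mul_projEmb_of_mem {a : ProjClifford hω (m + 1)}
    (ha : a ∈ ({xGate hω 0, zGate hω 0, xGate hω 0 * zGate hω 0} : Set _))
    (q : ProjClifford hω m) :
    IsConjIn (gateGroup hω m) (a * projEmb hω m q) (zGate hω 0 * projEmb hω m q) := by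
  obtain rfl | rfl | rfl := ha
  · exact isConjIn_gateGroup_xGate_mul_projEmb q
  · exact .refl _ _
  · exact (isConjIn_xStabilizer_xGate_mul_zGate q).mono xStabilizer_le_gateGroup

theorem isConjIn_gateGroup_projEmb_xGate :
    IsConjIn (gateGroup hω (m + 1)) (projEmb hω (m + 1) (xGate hω 0))
      (zGate hω 0 * projEmb hω (m + 1) (xGate hω 0)) := by
  rw [(commute_zGate_projEmb _).eq, projEmb_xGate]
  exact ⟨lamGate hω 0, lamGate_mem_gateGroup 0, semiconjBy_lamGate_xGate_succ 0⟩

theorem isConjIn_gateGroup_xGate {p : ProjClifford hω (m + 1)}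
    (hp : p ∈ pauliClasses hω (m + 1)) (hp1 : p ≠ 1) :
    IsConjIn (gateGroup hω m) p (xGate hω 0) := by
  refine .trans ?_ isConjIn_gateGroup_zGate_xGate
  induction m with
  | zero =>
    obtain ⟨a, ha, q, -, rfl⟩ := exists_eq_mul_projEmb_of_mem_pauliClasses hp
    obtain rfl : q = 1 := Subsingleton.elim q 1
    have ha1 : a ≠ 1 := by simpa using hp1
    simpa using isConjIn_gateGroup_zGate_mul_projEmb_of_mem (ha.resolve_left ha1) 1
  | succ m ih =>
    obtain ⟨a, ha, q, hq, rfl⟩ := exists_eq_mul_projEmb_of_mem_pauliClasses hp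
    by_cases hq1 : q = 1
    · subst hq1
      have ha1 : a ≠ 1 := by simpa using hp1
      simpa using isConjIn_gateGroup_zGate_mul_projEmb_of_mem (ha.resolve_left ha1) 1
    · have hqx : IsConjIn (gateGroup hω m) q (xGate hω 0) :=
        (ih hq hq1).trans isConjIn_gateGroup_zGate_xGate
      have hax : IsConjIn (gateGroup hω (m + 1)) (a * projEmb hω (m + 1) (xGate hω 0))
          (zGate hω 0 * projEmb hω (m + 1) (xGate hω 0)) := by
        obtain rfl | ha := ha
        · simpa only [one_mul] using isConjIn_gateGroup_projEmb_xGate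
        · exact isConjIn_gateGroup_zGate_mul_projEmb_of_mem ha _
      refine ((hqx.mul_projEmb (commute_projEmb_of_mem ha)).mono xStabilizer_le_gateGroup).trans
        (hax.trans ?_)
      exact isConjIn_xStabilizer_zGate_mul_projEmb_xGate.mono xStabilizer_le_gateGroup

theorem isConjIn_xStabilizer_zGate_mul_projEmb {q : ProjClifford hω m}
    (hq : q ∈ pauliClasses hω m) :
    IsConjIn (xStabilizer hω m) (zGate hω 0 * projEmb hω m q) (zGate hω 0) := by
  by_cases hq1 : q = 1
  · simpa [hq1] using .refl _ _
  cases m with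
  | zero => exact absurd (Subsingleton.elim q 1) hq1
  | succ m =>
    exact ((isConjIn_gateGroup_xGate hq hq1).mul_projEmb commute_zGate_projEmb).trans
      isConjIn_xStabilizer_zGate_mul_projEmb_xGate

theorem isConjIn_xStabilizer_zGate {p : ProjClifford hω (m + 1)}
    (hp : p ∈ pauliClasses hω (m + 1)) (hpx : ¬ LiftsCommute (xGate hω 0) p) :
    IsConjIn (xStabilizer hω m) p (zGate hω 0) := by
  obtain ⟨a, ha, q, hq, rfl⟩ := exists_eq_mul_projEmb_of_mem_pauliClasses hp
  have hqx : LiftsCommute (xGate hω 0) (projEmb hω m q) := liftsCommute_xGate_projEmb q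
  obtain rfl | rfl | rfl | rfl := ha
  · exact absurd (by rwa [one_mul]) hpx
  · exact absurd ((liftsCommute_xGate_self 0).mul_right hqx) hpx
  · exact isConjIn_xStabilizer_zGate_mul_projEmb hq
  · exact (isConjIn_xStabilizer_xGate_mul_zGate q).trans (isConjIn_xStabilizer_zGate_mul_projEmb hq)

theorem exists_mul_mem_range_projEmb_of_commute {a : ProjClifford hω (m + 1)}
    (hx : Commute a (xGate hω 0)) (hz : Commute a (zGate hω 0)) :
    ∃ g ∈ gateGroup hω m, g * a ∈ (projEmb hω m).range := by
  obtain ⟨g, hg, hgz, hgx⟩ : ∃ g ∈ gateGroup hω m, Commute (g * a) (zGate hω 0) ∧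
      LiftsCommute (g * a) (xGate hω 0) := by
    obtain h | h := liftsCommute_xGate_or_zGate_mul hx
    · exact ⟨1, one_mem _, by rwa [one_mul], by rwa [one_mul]⟩
    · exact ⟨zGate hω 0, zGate_mem_gateGroup 0, (Commute.refl _).mul_left hz, h⟩
  obtain h | h := liftsCommute_zGate_or_xGate_mul hgz
  · exact ⟨g, hg, mem_range_projEmb hgx h⟩
  · refine ⟨xGate hω 0 * g, mul_mem (xGate_mem_gateGroup 0) hg, ?_⟩
    rw [mul_assoc]
    exact mem_range_projEmb ((liftsCommute_xGate_self 0).mul_left hgx) h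

theorem exists_mul_mem_range_projEmb (a : ProjClifford hω (m + 1)) :
    ∃ g ∈ gateGroup hω m, g * a ∈ (projEmb hω m).range := by
  have hax := SemiconjBy.conj_mk a (xGate hω 0)
  obtain ⟨g, hg, hgx⟩ := isConjIn_gateGroup_xGate
    (mem_pauliClasses_of_semiconjBy (xGate_mem_pauliClasses 0) hax)
    (conj_eq_one_iff.not.mpr (xGate_ne_one 0))
  have hgax : Commute (g * a) (xGate hω 0) := hgx.mul_left hax
  have hgaz := SemiconjBy.conj_mk (g * a) (zGate hω 0)
  obtain ⟨k, hk, hkz⟩ := isConjIn_xStabilizer_zGate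
    (mem_pauliClasses_of_semiconjBy (zGate_mem_pauliClasses 0) hgaz) fun h =>
      not_liftsCommute_zGate_xGate 0 (h.of_semiconjBy hgax.inv_left hgaz.inv_symm_left).symm
  obtain ⟨hkG, hkx⟩ := mem_xStabilizer.mp hk
  obtain ⟨l, hl, hmem⟩ := exists_mul_mem_range_projEmb_of_commute (hkx.mul_left hgax)
    (hkz.mul_left hgaz)
  exact ⟨l * k * g, mul_mem (mul_mem hl hkG) hg, by simpa only [mul_assoc] using hmem⟩

theorem gateGroup_eq_top : gateGroup hω m = ⊤ := by
  refine (Subgroup.eq_top_iff' _).mpr fun a => ?_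
  induction m with
  | zero =>
    obtain ⟨g, hg, b, hb⟩ := exists_mul_mem_range_projEmb a
    rw [Subsingleton.elim b 1, map_one] at hb
    exact (Subgroup.mul_mem_cancel_left _ hg).mp (hb ▸ one_mem _)
  | succ m ih =>
    obtain ⟨g, hg, b, hb⟩ := exists_mul_mem_range_projEmb a
    exact (Subgroup.mul_mem_cancel_left _ hg).mp (hb ▸ projEmb_mem_gateGroup (ih b))

/-! ### The centralizer -/

theorem trace_tensor (A : Fin n → Matrix (Fin 2) (Fin 2) ℂ) :
    (tensor A).trace = ∏ j, (A j).trace := by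
  simp only [Matrix.trace, tensor, Matrix.diag_apply, Matrix.of_apply]
  rw [Finset.prod_univ_sum, Fintype.piFinset_univ]

theorem trace_onQubit_ne_zero (i : Fin n) {A : Matrix (Fin 2) (Fin 2) ℂ}
    (hA : A.trace ≠ 0) : (onQubit i A).trace ≠ 0 := by
  rw [onQubit, trace_tensor, Finset.prod_ne_zero_iff]
  intro j _
  obtain rfl | hji := eq_or_ne j i
  · rwa [Function.update_self]
  · simp [Function.update_of_ne hji]

theorem trace_matS_ne_zero (hω : IsPrimitiveRoot ω 8) :
    (matS hω : Matrix (Fin 2) (Fin 2) ℂ).trace ≠ 0 := by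
  intro h
  have h1 : 1 + ω ^ 2 = 0 := by simpa [matS, Matrix.trace_fin_two] using h
  have h2 : (1 : ℂ) = -1 := by linear_combination root_pow_four hω - (ω ^ 2 - 1) * h1
  norm_num at h2

theorem liftsCommute_sGate {g : ProjClifford hω m} {i : Fin m} (h : Commute g (sGate hω i)) :
    LiftsCommute g (sGate hω i) :=
  liftsCommute_of_trace_ne_zero (trace_onQubit_ne_zero i (trace_matS_ne_zero hω)) h

theorem liftsCommute_hGate_sGate_hGate {g : ProjClifford hω m} {i : Fin m}
    (h : Commute g (hGate hω i * sGate hω i * hGate hω i)) :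
    LiftsCommute g (hGate hω i * sGate hω i * hGate hω i) := by
  let H : cliffordGroup hω m := ⟨gateOn i matH, gateH_mem hω i⟩
  let S : cliffordGroup hω m := ⟨gateOn i (matS hω), gateS_mem hω i⟩
  have hHH : onQubit i matH.1 * onQubit i matH.1 = 1 := by
    rw [onQubit_mul, ← onQubit_one i]
    exact congr_arg (onQubit i ·.1) matH_sq
  have htrace : (onQubit i matH.1 * onQubit i (matS hω).1 * onQubit i matH.1).trace ≠ 0 := by
    rw [Matrix.trace_mul_cycle, hHH, one_mul]
    exact trace_onQubit_ne_zero i (trace_matS_ne_zero hω)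
  exact liftsCommute_of_trace_ne_zero (V := H * S * H) htrace h

theorem range_projEmb : (projEmb hω m).range = commonCentralizer hω m := by
  ext g
  rw [commonCentralizer, Subgroup.mem_centralizer_iff, Set.forall_mem_insert]
  constructor
  · rintro ⟨q, rfl⟩
    exact ⟨commute_sGate_projEmb q, fun _ ht => ht ▸ commute_hGate_sGate_hGate_projEmb q⟩
  · rintro ⟨hs, ht⟩
    have hs' := liftsCommute_sGate (Commute.symm hs)
    have ht' := liftsCommute_hGate_sGate_hGate (Commute.symm (ht _ rfl))
    exact mem_range_projEmb
      (hGate_sGate_hGate_mul_self (hω := hω) (0 : Fin (m + 1)) ▸ ht'.mul_right ht')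
      (sGate_mul_self (hω := hω) (0 : Fin (m + 1)) ▸ hs'.mul_right hs')

theorem commonCentralizer_zero : commonCentralizer hω 0 = ⊥ := by
  rw [← range_projEmb, MonoidHom.range_eq_bot_iff]
  exact Subsingleton.elim _ _

theorem commonCentralizer_succ : commonCentralizer hω (m + 1) =
    Subgroup.closure
      ({g | ∃ i : Fin (m + 2), i ≠ 0 ∧ g = hGate hω i} ∪
        {g | ∃ i : Fin (m + 2), i ≠ 0 ∧ g = sGate hω i} ∪
        {g | ∃ j : Fin (m + 1), (j : ℕ) ≠ 0 ∧ g = lamGate hω j}) := by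
  rw [← range_projEmb, MonoidHom.range_eq_map, ← gateGroup_eq_top, map_projEmb_gateGroup]

end

end QubitClifford

theorem mainTheorem6 (ω : ℂ) (hω : IsPrimitiveRoot ω 8) :
    QubitClifford.commonCentralizer hω 0 = ⊥ ∧
    QubitClifford.commonCentralizer hω 1 =
      Subgroup.closure {QubitClifford.hGate hω 1, QubitClifford.sGate hω 1} ∧
    ∀ m : ℕ, 2 ≤ m →
      QubitClifford.commonCentralizer hω m =
        Subgroup.closure
          ({g | ∃ i : Fin (m + 1), i ≠ 0 ∧ g = QubitClifford.hGate hω i} ∪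
            {g | ∃ i : Fin (m + 1), i ≠ 0 ∧ g = QubitClifford.sGate hω i} ∪
            {g | ∃ j : Fin m, (j : ℕ) ≠ 0 ∧ g = QubitClifford.lamGate hω j}) ∧
      ∃ φ : QubitClifford.ProjClifford hω m →* QubitClifford.ProjClifford hω (m + 1),
        Function.Injective φ ∧
        (∀ U : QubitClifford.cliffordGroup hω m,
          ∃ V : QubitClifford.cliffordGroup hω (m + 1),
            ((V : QubitClifford.QUnitary (m + 1)) : QubitClifford.QMatrix (m + 1)) =
              QubitClifford.idTensor ((U : QubitClifford.QUnitary m) : QubitClifford.QMatrix m) ∧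
            φ (QubitClifford.proj hω m U) = QubitClifford.proj hω (m + 1) V) ∧
        φ.range = QubitClifford.commonCentralizer hω m := by
  refine ⟨QubitClifford.commonCentralizer_zero, ?_, fun m hm => ⟨?_, QubitClifford.projEmb hω m,
    QubitClifford.projEmb_injective m, fun U => ⟨QubitClifford.cliffordEmb hω m U, rfl, rfl⟩,
    QubitClifford.range_projEmb⟩⟩
  · rw [QubitClifford.commonCentralizer_succ]
    congr 1
    ext g
    simp [Fin.exists_fin_succ, or_comm]
  · obtain ⟨k, rfl⟩ := Nat.exists_eq_add_of_le' (one_le_two.trans hm)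
    exact QubitClifford.commonCentralizer_succ
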